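/- Let $(G,\le)$ be an ordered group, i.e. a group with a total order such that $a\le b$ implies $xay\le xby$ for all $a,b,x,y\in G$. Write $[a,b]=a^{-1}b^{-1}ab$, $a^b=b^{-1}ab$ and $S^2=\{st : s,t\in S\}$. Let $S$ be a finite subset of $G$ with $|S|\ge 4$. If $|S^2|=3|S|-2$ and the subgroup $\langle S\rangle$ generated by $S$ is non-abelian, then there are elements $a,b,c$, or $x,c$, or $x,y,c$ of $G$ such that one of the following holds: (i) $S=\{a,ac,\dots,ac^i,\,b,bc,\dots,bc^j\}$ for some integers $i,j\ge 0$, where $[a,c]=[b,c]=1$, $c>1$, and either $ab=bac$ or $ba=abc$; (ii) $S=\{x,xc,xc^2,\dots,xc^{k-1}\}$ with $k=|S|$, where $c>1$ and either $c^x=c^2$ or $(c^2)^x=c$; (iii) $|S|=4$ and $S$ is of one of the following types: (a) $S=\{x,xc,xc^x,xc^{x^2}\}$ or $S=\{x^{-1},x^{-1}c,x^{-1}c^x,x^{-1}c^{x^2}\}$, with $c>1$ and $c^{x^2}=cc^x=c^xc$; (b) $S=\{1,c,c^2,x\}$, where either $c^x=c^2$ or $(c^2)^x=c$; (c) $S=\{x,xc,xc^2,y\}$,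 where $[c,x]=1$ and either $[x,y]=c=(c^2)^y$ or $[y,x]=c^2=c^y$; (d) $S=\{x,xc,xc^2,y\}$, where $[c,x]=[x,y]=1$ and either $c^y=c^2$ or $(c^2)^y=c$. Conversely, if $S$ (finite, with $|S|\ge 4$) satisfies (i), (ii) or case (b) of (iii), then $|S^2|=3|S|-2$. -/

import Mathlib

open scoped Pointwise

namespace SmallDoubling

/-- The conjugate `a ^ b = b⁻¹ a b`. -/
def conj {G : Type*} [Group G] (a b : G) : G := b⁻¹ * a * b

/-- The commutator `[a, b] = a⁻¹ b⁻¹ a b`. -/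
def comm {G : Type*} [Group G] (a b : G) : G := a⁻¹ * b⁻¹ * a * b

/-- The geometric progression `{x, x c, …, x c ^ (n - 1)}`. -/
def prog {G : Type*} [Group G] [DecidableEq G] (x c : G) (n : ℕ) : Finset G :=
  (Finset.range n).image (fun m => x * c ^ m)

variable {G : Type*} [Group G] [LinearOrder G]

/-- `S = {a, ac, …, ac^i, b, bc, …, bc^j}` with `[a, c] = [b, c] = 1`, `c > 1` and
either `ab = bac` or `ba = abc`. -/
def TypeI (S : Finset G) : Prop :=
  ∃ (a b c : G) (i j : ℕ),
    S = prog a c (i + 1) ∪ prog b c (j + 1) ∧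
    comm a c = 1 ∧ comm b c = 1 ∧ 1 < c ∧
    (a * b = b * a * c ∨ b * a = a * b * c)

/-- `S = {x, xc, …, xc^(k-1)}`, where `k = |S|`, with `c > 1` and either `c^x = c²` or
`(c²)^x = c`. -/
def TypeII (S : Finset G) : Prop :=
  ∃ x c : G,
    S = prog x c S.card ∧ 1 < c ∧ (conj c x = c ^ 2 ∨ conj (c ^ 2) x = c)

/-- `S = {x, xc, xc^x, xc^(x²)}` or `S = {x⁻¹, x⁻¹c, x⁻¹c^x, x⁻¹c^(x²)}`, with `c > 1` and
`c^(x²) = c c^x = c^x c`. -/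
def TypeIIIa (S : Finset G) : Prop :=
  ∃ x c : G,
    (S = {x, x * c, x * conj c x, x * conj c (x ^ 2)} ∨
      S = {x⁻¹, x⁻¹ * c, x⁻¹ * conj c x, x⁻¹ * conj c (x ^ 2)}) ∧
    1 < c ∧ conj c (x ^ 2) = c * conj c x ∧ c * conj c x = conj c x * c

/-- `S = {1, c, c², x}`, where either `c^x = c²` or `(c²)^x = c`. -/
def TypeIIIb (S : Finset G) : Prop :=
  ∃ x c : G,
    S = {1, c, c ^ 2, x} ∧ (conj c x = c ^ 2 ∨ conj (c ^ 2) x = c)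

/-- `S = {x, xc, xc², y}`, where `[c, x] = 1` and either `[x, y] = c = (c²)^y` or
`[y, x] = c² = c^y`. -/
def TypeIIIc (S : Finset G) : Prop :=
  ∃ x y c : G,
    S = {x, x * c, x * c ^ 2, y} ∧ comm c x = 1 ∧
    ((comm x y = c ∧ c = conj (c ^ 2) y) ∨ (comm y x = c ^ 2 ∧ c ^ 2 = conj c y))

/-- `S = {x, xc, xc², y}`, where `[c, x] = [x, y] = 1` and either `c^y = c²` or
`(c²)^y = c`. -/
def TypeIIId (S : Finset G) : Prop :=
  ∃ x y c : G,
    S = {x, x * c, x * c ^ 2, y} ∧ comm c x = 1 ∧ comm x y = 1 ∧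
    (conj c y = c ^ 2 ∨ conj (c ^ 2) y = c)

end SmallDoubling

/-! Adjoining to a finite set `T` a new largest element `y` so that the result is nonabelian creates
at least three products (`card_mul_self_add_three_le`). Two of them are `y * y` and `y * b`, where
`b` is the maximum of `T`. The third is `b * y` if `b` and `y` do not commute; otherwise it is the
larger of `z * y` and `y * z`, where `z` is the largest element failing to commute with something
above it. Inversion gives the same for a new smallest element. If `T` is abelian, commutation itself
separates `T * T` from the products involving `y` (`card_mul_insert_of_isAbelian`). Hence `3|S| - 2`
is a lower bound for the square of every nonabelian `S`, and the converse direction only needs upper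
bounds.

In the extremal case, deleting the largest or the smallest element leaves an abelian set or an
extremal set again. The set is therefore listed increasingly and classified by induction on its
size, by gluing the descriptions of its two overlapping windows.

For an abelian set plus one element `y`, the abelian part is a progression (`exists_eq_prog`), and
its left and right translates by `y` are progressions differing in one element (`prog_union_prog`);
this gives type I with a singleton block, or types III (c) and (d). For four elements with no
commuting triple, the bound of ten products forces equations between products. Order and
cancellation then leave two commuting pairs with a common ratio, a progression whose ratio is
squared by conjugation, a golden quadruple, or the images of these in the opposite group
(`Quad.classification`).

In the induction, sets with one exceptional element or two commuting blocks never contain three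
consecutive pairwise noncommuting elements, whereas in the other shapes all consecutive triples are
such. So the two kinds never mix, and within each kind the overlap of the windows determines how
they fit together. -/

namespace SmallDoubling

/-! ### Lower bounds for the square of a nonabelian set. -/

section Basic

open Finset

variable {G : Type*} [Group G]

/-- The elements of `S` commute pairwise. -/
def IsAbelian (S : Finset G) : Prop := ∀ a ∈ S, ∀ b ∈ S, Commute a b

theorem IsAbelian.mono {S T : Finset G} (h : IsAbelian T) (hST : S ⊆ T) : IsAbelian S :=
  fun a ha b hb => h a (hST ha) b (hST hb)

theorem commute_of_mul_left {a b c : G} (hb : Commute a b) (h : Commute a (b * c)) :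
    Commute a c := by
  have := hb.inv_right.mul_right h
  rwa [inv_mul_cancel_left] at this

theorem commute_of_mul_right {a b c : G} (hc : Commute a c) (h : Commute a (b * c)) :
    Commute a b := by
  have := h.mul_right hc.inv_right
  rwa [mul_inv_cancel_right] at this

/-- The second half is the equality case: it turns an upper bound on the number of products into a
list of the values a product can take. -/
theorem card_add_three_le {α : Type*} [DecidableEq α] {A B : Finset α}
    (hAB : A ⊆ B) {p q r : α} (hp : p ∈ B) (hq : q ∈ B)
    (hr : r ∈ B) (hpA : p ∉ A) (hqA : q ∉ A) (hrA : r ∉ A) (hpq : p ≠ q) (hpr : p ≠ r)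
    (hqr : q ≠ r) :
    A.card + 3 ≤ B.card ∧ (B.card ≤ A.card + 3 → ∀ g ∈ B, g ∈ A ∨ g = p ∨ g = q ∨ g = r) := by
  have hsub : A ∪ {p, q, r} ⊆ B := by
    intro g hg
    simp only [mem_union, mem_insert, mem_singleton] at hg
    rcases hg with h | rfl | rfl | rfl
    exacts [hAB h, hp, hq, hr]
  have hcard : (A ∪ {p, q, r}).card = A.card + 3 := by
    rw [card_union_of_disjoint, card_eq_three.mpr ⟨p, q, r, hpq, hpr, hqr, rfl⟩]
    simp [hpA, hqA, hrA]
  refine ⟨hcard ▸ card_le_card hsub, fun hle g hg => ?_⟩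
  have := eq_of_subset_of_card_le hsub (by omega)
  rw [← this] at hg
  simpa only [mem_union, mem_insert, mem_singleton] using hg

variable [LinearOrder G]

theorem isAbelian_insert {T : Finset G} {y : G} (hT : IsAbelian T) (hy : ∀ t ∈ T, Commute t y) :
    IsAbelian (insert y T) := by
  intro a ha b hb
  rw [mem_insert] at ha hb
  rcases ha with rfl | ha <;> rcases hb with rfl | hb
  · exact Commute.refl _
  · exact (hy b hb).symm
  · exact hy a ha
  · exact hT a ha b hb

/-- Inversion reverses the order and preserves the size of a square, so statements about a new
maximum become statements about a new minimum. -/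
theorem inv_insert_mul_inv_insert (T : Finset G) (y : G) :
    insert y⁻¹ T⁻¹ * insert y⁻¹ T⁻¹ = (insert y T * insert y T)⁻¹ := by
  rw [mul_inv_rev, inv_insert]

theorem isAbelian_inv {T : Finset G} : IsAbelian T⁻¹ ↔ IsAbelian T := by
  have key : ∀ T : Finset G, IsAbelian T → IsAbelian T⁻¹ := by
    intro T h a ha b hb
    have := h _ (mem_inv'.mp ha) _ (mem_inv'.mp hb)
    simpa using this.inv_inv
  exact ⟨fun h => by simpa using key _ h, key T⟩

variable [MulLeftMono G] [MulRightMono G]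

/-- Roots are unique in an ordered group, and `b` and its conjugate by `a` have the same `n`-th
power. -/
theorem commute_of_commute_pow {a b : G} {n : ℕ} (hn : n ≠ 0) (h : Commute a (b ^ n)) :
    Commute a b := by
  have h1 : (a * b * a⁻¹) ^ n = b ^ n := by
    rw [conj_pow, h.eq, mul_inv_cancel_right]
  have h2 : a * b * a⁻¹ = b := pow_left_injective hn h1
  exact mul_inv_eq_iff_eq_mul.mp h2

theorem commute_of_commute_mul_self {a b : G} (h : Commute a (b * b)) : Commute a b :=
  commute_of_commute_pow two_ne_zero (by rwa [pow_two])

/-- Adding a new largest element to a set creates two or three products that are certainly new,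
provided that the result is not abelian. -/
theorem exists_new_products {T : Finset G} {y : G} (hy : ∀ t ∈ T, t < y)
    (hna : ¬ IsAbelian (insert y T)) :
    ∃ b ∈ T, (∀ t ∈ T, t ≤ b) ∧
      ((¬ Commute b y ∧ y * b ∉ T * T ∧ b * y ∉ T * T) ∨
        (Commute b y ∧ ∃ z ∈ T, z < b ∧ (∃ u ∈ insert y T, z < u ∧ ¬ Commute z u) ∧
          (∀ s ∈ insert y T, z < s → ∀ t ∈ insert y T, z < t → Commute s t) ∧
          max (z * y) (y * z) ∉ T * T)) := by
  have hne : T.Nonempty := by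
    rw [nonempty_iff_ne_empty]
    rintro rfl
    exact hna (isAbelian_insert (by simp [IsAbelian]) (by simp))
  have hb := T.max'_mem hne
  have hbm : ∀ t ∈ T, t ≤ T.max' hne := fun t ht => T.le_max' t ht
  generalize T.max' hne = b at hb hbm
  refine ⟨b, hb, hbm, ?_⟩
  have hle : ∀ {s t}, s ∈ T → t ∈ T → s * t ≤ b * b :=
    fun hs ht => mul_le_mul' (hbm _ hs) (hbm _ ht)
  by_cases hc : Commute b y
  · right
    refine ⟨hc, ?_⟩
    classical
    -- The maximum `z` of `F` fails to commute with some larger `u`, while all elements above `z`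
    -- commute pairwise.
    set F := T.filter (fun t => ∃ u ∈ insert y T, t < u ∧ ¬ Commute t u) with hF
    have hFne : F.Nonempty := by
      by_contra hFe
      rw [not_nonempty_iff_eq_empty] at hFe
      have key : ∀ s ∈ T, ∀ t ∈ insert y T, s < t → Commute s t := by
        intro s hs t ht hst
        by_contra hcon
        have : s ∈ F := by
          rw [hF, mem_filter]; exact ⟨hs, t, ht, hst, hcon⟩
        simp [hFe] at this
      refine hna (isAbelian_insert ?_ fun t ht => key t ht y (mem_insert_self _ _) (hy t ht))
      intro s hs t ht
      rcases lt_trichotomy s t with h | rfl | h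
      · exact key s hs t (mem_insert_of_mem ht) h
      · exact Commute.refl _
      · exact (key t ht s (mem_insert_of_mem hs) h).symm
    have hz := F.max'_mem hFne
    have hzm : ∀ t ∈ F, t ≤ F.max' hFne := fun t ht => F.le_max' t ht
    generalize F.max' hFne = z at hz hzm
    rw [hF, mem_filter] at hz
    obtain ⟨hzT, u, hu, hzu, hncu⟩ := hz
    have hlt : ∀ s ∈ insert y T, z < s → ∀ t ∈ insert y T, s < t → Commute s t := by
      intro s hs hzs t ht hst
      by_contra hcon
      have hsT : s ∈ T := by
        rcases mem_insert.mp hs with rfl | h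
        · rcases mem_insert.mp ht with rfl | h'
          · exact absurd hst (lt_irrefl _)
          · exact absurd hst (hy t h').not_gt
        · exact h
      have : s ∈ F := by
        rw [hF, mem_filter]; exact ⟨hsT, t, ht, hst, hcon⟩
      exact absurd hzs (hzm s this).not_gt
    have hU : ∀ s ∈ insert y T, z < s → ∀ t ∈ insert y T, z < t → Commute s t := by
      intro s hs hzs t ht hzt
      rcases lt_trichotomy s t with h | rfl | h
      · exact hlt s hs hzs t ht h
      · exact Commute.refl _
      · exact (hlt t ht hzt s hs h).symm
    have hzb : z < b := by
      rcases (hbm z hzT).lt_or_eq with h | rfl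
      · exact h
      · rcases mem_insert.mp hu with rfl | h
        · exact absurd hc hncu
        · exact absurd hzu (hbm u h).not_gt
    refine ⟨z, hzT, hzb, ⟨u, hu, hzu, hncu⟩, hU, ?_⟩
    -- A product with a factor at most `z` is too small. If both factors exceed `z`, the product
    -- commutes with `u`; since `y` does too, so would `z`.
    intro hM
    obtain ⟨s, hs, t, ht, hst⟩ := mem_mul.mp hM
    have hby : b < y := hy b hb
    rcases le_or_gt s z with hsz | hsz
    · have h1 : s * t ≤ z * b := mul_le_mul' hsz (hbm t ht)
      have h2 : z * b < z * y := mul_lt_mul_right hby z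
      exact absurd hst ((h1.trans_lt h2).trans_le (le_max_left _ _)).ne
    rcases le_or_gt t z with htz | htz
    · have h1 : s * t ≤ b * z := mul_le_mul' (hbm s hs) htz
      have h2 : b * z < y * z := mul_lt_mul_left hby z
      exact absurd hst ((h1.trans_lt h2).trans_le (le_max_right _ _)).ne
    have hcu : Commute u (s * t) :=
      (hU u hu hzu s (mem_insert_of_mem hs) hsz).mul_right
        (hU u hu hzu t (mem_insert_of_mem ht) htz)
    have hyu : Commute u y := hU u hu hzu y (mem_insert_self _ _) (hy z hzT)
    rw [hst] at hcu
    rcases max_choice (z * y) (y * z) with h | h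
    · rw [h] at hcu
      exact hncu (commute_of_mul_right hyu hcu).symm
    · rw [h] at hcu
      exact hncu (commute_of_mul_left hyu hcu).symm
  · left
    refine ⟨hc, ?_, ?_⟩
    · intro h
      obtain ⟨s, hs, t, ht, hst⟩ := mem_mul.mp h
      have h2 : b * b < y * b := mul_lt_mul_left (hy b hb) b
      exact absurd hst ((hle hs ht).trans_lt h2).ne
    · intro h
      obtain ⟨s, hs, t, ht, hst⟩ := mem_mul.mp h
      have h2 : b * b < b * y := mul_lt_mul_right (hy b hb) b
      exact absurd hst ((hle hs ht).trans_lt h2).ne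

theorem mul_self_notMem {T : Finset G} {y : G} (hy : ∀ t ∈ T, t < y) : y * y ∉ T * T := by
  intro h
  obtain ⟨s, hs, t, ht, hst⟩ := mem_mul.mp h
  exact absurd hst (mul_lt_mul_of_lt_of_lt (hy s hs) (hy t ht)).ne

/-- The new products of `exists_new_products` are distinct from each other: `b * y` and `y * b` lie
below `y * y`, and in the commuting case the third one lies below `y * b`. -/
theorem card_mul_self_add_three_le {T : Finset G} {y : G} (hy : ∀ t ∈ T, t < y)
    (hna : ¬ IsAbelian (insert y T)) :
    (T * T).card + 3 ≤ (insert y T * insert y T).card := by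
  obtain ⟨b, hb, hbm, hcase⟩ := exists_new_products hy hna
  have hyy := mul_self_notMem hy
  have hby := hy b hb
  have hym := mem_insert_self y T
  have hsub : T * T ⊆ insert y T * insert y T :=
    mul_subset_mul (subset_insert _ _) (subset_insert _ _)
  have hlt1 : y * b < y * y := mul_lt_mul_right hby y
  have hlt2 : b * y < y * y := mul_lt_mul_left hby y
  have hbS := mem_insert_of_mem (a := b) (b := y) hb
  rcases hcase with ⟨hnc, h1, h2⟩ | ⟨hc, z, hz, hzb, -, -, h3⟩
  · exact (card_add_three_le hsub (mul_mem_mul hym hym) (mul_mem_mul hym hbS)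
      (mul_mem_mul hbS hym) hyy h1 h2 hlt1.ne' hlt2.ne' fun h => hnc h.symm).1
  · have h1 : y * b ∉ T * T := by
      intro h
      obtain ⟨s, hs, t, ht, hst⟩ := mem_mul.mp h
      have h2 : b * b < y * b := mul_lt_mul_left hby b
      exact absurd hst ((mul_le_mul' (hbm _ hs) (hbm _ ht)).trans_lt h2).ne
    have hMS : max (z * y) (y * z) ∈ insert y T * insert y T := by
      rcases max_choice (z * y) (y * z) with h | h <;> rw [h]
      · exact mul_mem_mul (mem_insert_of_mem hz) hym
      · exact mul_mem_mul hym (mem_insert_of_mem hz)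
    have hMlt : max (z * y) (y * z) < y * b := by
      rw [max_lt_iff]
      refine ⟨?_, mul_lt_mul_right hzb y⟩
      rw [← hc.eq]
      exact mul_lt_mul_left hzb y
    exact (card_add_three_le hsub (mul_mem_mul hym hym) (mul_mem_mul hym hbS) hMS hyy h1 h3
      hlt1.ne' (hMlt.trans hlt1).ne' hMlt.ne').1

theorem card_mul_self_add_three_le_of_min {T : Finset G} {y : G} (hy : ∀ t ∈ T, y < t)
    (hna : ¬ IsAbelian (insert y T)) :
    (T * T).card + 3 ≤ (insert y T * insert y T).card := by
  have h := card_mul_self_add_three_le (T := T⁻¹) (y := y⁻¹)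
    (fun t ht => by
      have := hy _ (mem_inv'.mp ht)
      exact lt_inv_of_lt_inv this)
    (by rwa [← inv_insert, isAbelian_inv])
  rwa [inv_insert_mul_inv_insert, card_inv, ← mul_inv_rev, card_inv] at h

/-- A finite set stable under conjugation by `y` is centralized by `y`. -/
theorem commute_of_mul_eq_mul {T : Finset G} {y : G} (h : {y} * T = T * {y}) :
    ∀ t ∈ T, Commute t y := by
  have hmap : ∀ t ∈ T, y * t * y⁻¹ ∈ T := by
    intro t ht
    have : y * t ∈ T * {y} := h ▸ mul_mem_mul (mem_singleton_self y) ht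
    obtain ⟨s, hs, y', hy', hst⟩ := mem_mul.mp this
    rw [mem_singleton] at hy'
    subst hy'
    rw [← hst, mul_inv_cancel_right]
    exact hs
  -- Conjugation is a strictly increasing map of a finite chain into itself, hence the identity.
  let f : T → T := fun t => ⟨y * t * y⁻¹, hmap t t.2⟩
  have hf : StrictMono f := fun s t hst =>
    mul_lt_mul_left (mul_lt_mul_right (show (s : G) < t from hst) y) y⁻¹
  have hid : Set.range f = Set.range (id : T → T) := by
    rw [(Finite.surjective_of_injective hf.injective).range_eq, Set.range_id]
  have := (StrictMono.range_inj hf strictMono_id).mp hid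
  intro t ht
  have h2 := congrArg Subtype.val (congrFun this ⟨t, ht⟩)
  exact (mul_inv_eq_iff_eq_mul.mp h2).symm

/-- An element `t₀` of `T` not commuting with `y` commutes with every product inside `T * T` and
with no product having exactly one factor `y`, so these sets are disjoint. If the mixed products
were only `|T|` in number, the two translates of `T` by `y` would coincide and `y` would centralize
`T`. -/
theorem card_mul_insert_of_isAbelian {T : Finset G} {y : G} (hT : IsAbelian T)
    (hna : ∃ t ∈ T, ¬ Commute t y) :
    (insert y T * insert y T).card = (T * T).card + ({y} * T ∪ T * {y}).card + 1 ∧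
      T.card + 1 ≤ ({y} * T ∪ T * {y}).card := by
  obtain ⟨t₀, ht₀, hnc⟩ := hna
  have hcT : ∀ g ∈ T * T, Commute t₀ g := by
    intro g hg
    obtain ⟨s, hs, t, ht, rfl⟩ := mem_mul.mp hg
    exact (hT _ ht₀ _ hs).mul_right (hT _ ht₀ _ ht)
  have hncm : ∀ g ∈ {y} * T ∪ T * {y}, ¬ Commute t₀ g := by
    intro g hg hc
    rw [mem_union] at hg
    rcases hg with hg | hg
    · obtain ⟨y', hy', t, ht, rfl⟩ := mem_mul.mp hg
      rw [mem_singleton] at hy'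
      subst hy'
      exact hnc (commute_of_mul_right (hT _ ht₀ _ ht) hc)
    · obtain ⟨t, ht, y', hy', rfl⟩ := mem_mul.mp hg
      rw [mem_singleton] at hy'
      subst hy'
      exact hnc (commute_of_mul_left (hT _ ht₀ _ ht) hc)
  have hyT : y ∉ T := fun h => hnc (hT _ ht₀ _ h)
  have heq : insert y T * insert y T = insert (y * y) (T * T ∪ ({y} * T ∪ T * {y})) := by
    ext g
    simp only [mem_mul, mem_insert, mem_union, mem_singleton]
    constructor
    · rintro ⟨s, rfl | hs, t, rfl | ht, rfl⟩
      · exact Or.inl rfl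
      · exact Or.inr (Or.inr (Or.inl ⟨_, rfl, t, ht, rfl⟩))
      · exact Or.inr (Or.inr (Or.inr ⟨s, hs, _, rfl, rfl⟩))
      · exact Or.inr (Or.inl ⟨s, hs, t, ht, rfl⟩)
    · rintro (rfl | ⟨s, hs, t, ht, rfl⟩ | ⟨s, rfl, t, ht, rfl⟩ | ⟨s, hs, t, rfl, rfl⟩)
      · exact ⟨y, Or.inl rfl, y, Or.inl rfl, rfl⟩
      · exact ⟨s, Or.inr hs, t, Or.inr ht, rfl⟩
      · exact ⟨s, Or.inl rfl, t, Or.inr ht, rfl⟩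
      · exact ⟨s, Or.inr hs, t, Or.inl rfl, rfl⟩
  refine ⟨?_, ?_⟩
  · rw [heq, card_insert_of_notMem, card_union_of_disjoint]
    · rw [disjoint_left]
      exact fun g h1 h2 => hncm g h2 (hcT g h1)
    · rw [mem_union, not_or]
      refine ⟨fun h => hnc (commute_of_commute_mul_self (hcT _ h)), fun h => ?_⟩
      rw [mem_union] at h
      rcases h with h | h
      · obtain ⟨y', hy', t, ht, h⟩ := mem_mul.mp h
        rw [mem_singleton] at hy'
        subst hy'
        exact hyT (mul_left_cancel h ▸ ht)
      · obtain ⟨t, ht, y', hy', h⟩ := mem_mul.mp h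
        rw [mem_singleton] at hy'
        subst hy'
        exact hyT (mul_right_cancel h ▸ ht)
  · by_contra hlt
    have hle1 : ({y} * T ∪ T * {y}).card ≤ ({y} * T).card := by
      rw [card_singleton_mul]; omega
    have hle2 : ({y} * T ∪ T * {y}).card ≤ (T * {y}).card := by
      rw [card_mul_singleton]; omega
    have e1 := eq_of_subset_of_card_le subset_union_left hle1
    have e2 := eq_of_subset_of_card_le subset_union_right hle2
    exact hnc (commute_of_mul_eq_mul (e1.trans e2.symm) t₀ ht₀)

theorem two_mul_card_le (T : Finset G) (hT : T.Nonempty) :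
    2 * T.card ≤ (T * T).card + 1 := by
  have := cauchy_davenport_mul_of_linearOrder_isCancelMul hT hT
  omega

/-- Removing maxima costs three products each time until the remaining set `T` is abelian; then the
count is at least `(2|T| - 1) + (|T| + 1) + 1`. -/
theorem three_mul_card_le {S : Finset G} (hS : ¬ IsAbelian S) :
    3 * S.card ≤ (S * S).card + 2 := by
  induction S using Finset.induction_on_max with
  | empty => simp
  | insert y T hy ih =>
    have hyT : y ∉ T := fun h => lt_irrefl _ (hy y h)
    rw [card_insert_of_notMem hyT]
    by_cases hT : IsAbelian T
    · have hna : ∃ t ∈ T, ¬ Commute t y := by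
        by_contra! hcon
        exact hS (isAbelian_insert hT hcon)
      have := card_mul_insert_of_isAbelian hT hna
      have := two_mul_card_le T ⟨_, hna.choose_spec.1⟩
      omega
    · have := ih hT
      have := card_mul_self_add_three_le hy hS
      omega

end Basic

/-! ### Abelian sets with small square, and one further element. -/

section Progressions

open Finset

variable {G : Type*} [Group G] [LinearOrder G]

theorem mem_prog {x c g : G} {n : ℕ} : g ∈ prog x c n ↔ ∃ i < n, x * c ^ i = g := by
  simp [prog]

theorem prog_succ (x c : G) (n : ℕ) : prog x c (n + 1) = insert (x * c ^ n) (prog x c n) := by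
  simp [prog, range_add_one]

/-- Two sets of size `n + 1` in increasing enumeration whose union has `n + 2` elements agree
after the omission of one element of each. -/
theorem exists_succAbove_eq {α : Type*} [LinearOrder α] {n : ℕ}
    {a b : Fin (n + 1) → α} (ha : StrictMono a) (hb : StrictMono b)
    (h : (univ.image a ∪ univ.image b).card = n + 2) :
    ∃ p q : Fin (n + 1), ∀ i : Fin n, a (p.succAbove i) = b (q.succAbove i) := by
  have hca : (univ.image a).card = n + 1 := by
    rw [card_image_of_injective _ ha.injective, card_univ, Fintype.card_fin]
  have hcb : (univ.image b).card = n + 1 := by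
    rw [card_image_of_injective _ hb.injective, card_univ, Fintype.card_fin]
  have h1 : (univ.image a \ univ.image b).card = 1 := by
    have := card_sdiff_add_card (univ.image a) (univ.image b)
    omega
  have h2 : (univ.image b \ univ.image a).card = 1 := by
    have := card_sdiff_add_card (univ.image b) (univ.image a)
    rw [union_comm] at this
    omega
  obtain ⟨s, hs⟩ := card_eq_one.mp h1
  obtain ⟨t, ht⟩ := card_eq_one.mp h2
  have hsa : s ∈ univ.image a \ univ.image b := hs ▸ mem_singleton_self s
  have htb : t ∈ univ.image b \ univ.image a := ht ▸ mem_singleton_self t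
  rw [mem_sdiff, mem_image] at hsa htb
  obtain ⟨⟨p, -, rfl⟩, hpb⟩ := hsa
  obtain ⟨⟨q, -, rfl⟩, hqa⟩ := htb
  refine ⟨p, q, fun i => ?_⟩
  -- After the omissions both sequences enumerate the intersection increasingly, so they agree term
  -- by term.
  have key : Set.range (a ∘ p.succAbove) = Set.range (b ∘ q.succAbove) := by
    rw [Set.range_comp, Set.range_comp, Fin.range_succAbove, Fin.range_succAbove]
    ext g
    simp only [Set.mem_image, Set.mem_compl_iff, Set.mem_singleton_iff]
    constructor
    · rintro ⟨i, hi, rfl⟩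
      have : a i ∈ univ.image b := by
        by_contra hcon
        have : a i ∈ univ.image a \ univ.image b :=
          mem_sdiff.mpr ⟨mem_image_of_mem _ (mem_univ _), hcon⟩
        rw [hs, mem_singleton] at this
        exact hi (ha.injective this)
      obtain ⟨j, -, hj⟩ := mem_image.mp this
      refine ⟨j, ?_, hj⟩
      rintro rfl
      exact hqa (hj ▸ mem_image_of_mem _ (mem_univ _))
    · rintro ⟨i, hi, rfl⟩
      have : b i ∈ univ.image a := by
        by_contra hcon
        have : b i ∈ univ.image b \ univ.image a :=
          mem_sdiff.mpr ⟨mem_image_of_mem _ (mem_univ _), hcon⟩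
        rw [ht, mem_singleton] at this
        exact hi (hb.injective this)
      obtain ⟨j, -, hj⟩ := mem_image.mp this
      refine ⟨j, ?_, hj⟩
      rintro rfl
      exact hpb (hj ▸ mem_image_of_mem _ (mem_univ _))
  exact congrFun ((StrictMono.range_inj (ha.comp (Fin.strictMono_succAbove p))
    (hb.comp (Fin.strictMono_succAbove q))).mp key) i

theorem succAbove_val {n : ℕ} (p : Fin (n + 1)) (i : Fin n) :
    (p.succAbove i : ℕ) = if (i : ℕ) < p then (i : ℕ) else i + 1 := by
  rw [Fin.succAbove]
  split_ifs with h1 h2 h2 <;> simp_all [Fin.lt_def]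

theorem strictMono_mul_pow [MulLeftMono G] {c : G} (x : G) (hc : 1 < c) :
    StrictMono fun i : ℕ => x * c ^ i :=
  fun _ _ hij => mul_lt_mul_right (pow_right_strictMono' hc hij) x

theorem card_prog [MulLeftMono G] {c : G} (x : G) (hc : 1 < c) (n : ℕ) : (prog x c n).card = n := by
  rw [prog, card_image_of_injective _ (strictMono_mul_pow x hc).injective, card_range]

variable [MulLeftMono G] [MulRightMono G]

/-- Equality in `2 |T| - 1 ≤ |T * T|` for an abelian set `T` forces a geometric progression. -/
theorem exists_eq_prog {T : Finset G} (hT : IsAbelian T) (h2 : 2 ≤ T.card)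
    (hcard : (T * T).card + 1 ≤ 2 * T.card) :
    ∃ x c : G, 1 < c ∧ Commute x c ∧ T = prog x c T.card := by
  induction T using Finset.induction_on_max with
  | empty => simp at h2
  | insert y T hy ih =>
    have hyT : y ∉ T := fun h => lt_irrefl _ (hy y h)
    rw [card_insert_of_notMem hyT] at h2 hcard ⊢
    have hTa := hT.mono (subset_insert y T)
    rcases Nat.lt_or_ge T.card 2 with h1 | h1
    · obtain ⟨x, rfl⟩ := card_eq_one.mp (show T.card = 1 by omega)
      have hxy := hy x (mem_singleton_self x)
      have hcomm : Commute x y := hT _ (by simp) _ (by simp)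
      refine ⟨x, x⁻¹ * y, by rwa [lt_inv_mul_iff_mul_lt, mul_one],
        (Commute.refl x).inv_right.mul_right hcomm, ?_⟩
      rw [card_singleton, prog_succ, prog_succ, pow_one, mul_inv_cancel_left, pow_zero, mul_one]
      simp [prog]
    · have hne : T.Nonempty := card_pos.mp (by omega)
      have hb := T.max'_mem hne
      have hbm : ∀ t ∈ T, t ≤ T.max' hne := fun t ht => T.le_max' t ht
      generalize T.max' hne = b at hb hbm
      have hyy := mul_self_notMem hy
      have hyb : y * b ∉ T * T := by
        intro h
        obtain ⟨s, hs, t, ht, hst⟩ := mem_mul.mp h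
        exact absurd hst ((mul_le_mul' (hbm _ hs) (hbm _ ht)).trans_lt
          (mul_lt_mul_left (hy b hb) b)).ne
      have hne' : y * b ≠ y * y := fun h => (hy b hb).ne (mul_left_cancel h)
      have hsub : insert (y * b) (insert (y * y) (T * T)) ⊆ insert y T * insert y T := by
        intro g hg
        simp only [mem_insert] at hg
        rcases hg with rfl | rfl | hg
        · exact mul_mem_mul (mem_insert_self _ _) (mem_insert_of_mem hb)
        · exact mul_mem_mul (mem_insert_self _ _) (mem_insert_self _ _)
        · exact mul_subset_mul (subset_insert _ _) (subset_insert _ _) hg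
      have hc2 : (insert (y * b) (insert (y * y) (T * T))).card = (T * T).card + 2 := by
        rw [card_insert_of_notMem, card_insert_of_notMem hyy]
        simp [hyb, hne']
      have hle := card_le_card hsub
      have hlow := two_mul_card_le T hne
      have heq := eq_of_subset_of_card_le hsub (by omega)
      obtain ⟨x, c, hc, hxc, hTp⟩ := ih hTa h1 (by omega)
      obtain ⟨n, hn⟩ : ∃ n, T.card = n + 2 := ⟨T.card - 2, by omega⟩
      rw [hn] at hTp ⊢
      have hmono := strictMono_mul_pow x hc
      have hbx : b = x * c ^ (n + 1) := by
        refine le_antisymm ?_ (hbm _ (hTp ▸ mem_prog.mpr ⟨n + 1, by omega, rfl⟩))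
        rw [hTp, mem_prog] at hb
        obtain ⟨i, hi, rfl⟩ := hb
        exact hmono.monotone (by omega)
      -- Only `y * b` and `y * y` are new, so `y` times the second largest element of `T` already
      -- lies in `T * T`. It exceeds `b` times that element, which leaves only the top exponent `2 *
      -- n + 2` and thereby determines `y`.
      have ha : x * c ^ n ∈ T := hTp ▸ mem_prog.mpr ⟨n, by omega, rfl⟩
      have hab : x * c ^ n < b := hbx ▸ hmono (Nat.lt_succ_self n)
      have hya : y * (x * c ^ n) ∈ insert y T * insert y T :=
        mul_mem_mul (mem_insert_self _ _) (mem_insert_of_mem ha)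
      rw [← heq, mem_insert, mem_insert] at hya
      have hprod : ∀ i j : ℕ, x * c ^ i * (x * c ^ j) = x * x * c ^ (i + j) := by
        intro i j
        rw [pow_add, mul_assoc, ← mul_assoc (c ^ i), ← (hxc.pow_right i).eq]
        simp only [mul_assoc]
      have hyx : y = x * c ^ (n + 2) := by
        rcases hya with h | h | h
        · exact absurd (mul_left_cancel h) hab.ne
        · exact absurd (mul_left_cancel h) (hab.trans (hy b hb)).ne
        · obtain ⟨s, hs, t, ht, hst⟩ := mem_mul.mp h
          rw [hTp, mem_prog] at hs ht
          obtain ⟨i, hi, rfl⟩ := hs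
          obtain ⟨j, hj, rfl⟩ := ht
          have hlt : x * c ^ (n + 1) * (x * c ^ n) < x * c ^ i * (x * c ^ j) := by
            rw [hst, ← hbx]
            exact mul_lt_mul_left (hy b hb) _
          rw [hprod, hprod] at hlt
          have hij := (strictMono_mul_pow (x * x) hc).lt_iff_lt.mp hlt
          have : i + j = n + 2 + n := by omega
          rw [hprod, this, ← hprod] at hst
          exact (mul_right_cancel hst).symm
      refine ⟨x, c, hc, hxc, ?_⟩
      rw [prog_succ, ← hTp, hyx]

theorem sq_eq_of_mul_sq {c d u w : G} (h1 : u = w) (h2 : u * c ^ 2 = w * d ^ 2) : c = d := by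
  subst h1
  exact pow_left_injective two_ne_zero (mul_left_cancel h2)

/-- Two progressions of the same length at least three which differ in exactly one element. -/
theorem prog_union_prog {u w c d : G} (hc : 1 < c) (hd : 1 < d) {n : ℕ} (hn : 2 ≤ n)
    (h : (prog u c (n + 1) ∪ prog w d (n + 1)).card = n + 2) :
    (c = d ∧ (w = u * c ∨ u = w * c)) ∨
      (n = 2 ∧ ((d = c ^ 2 ∧ (u = w ∨ u = w * d)) ∨ (c = d ^ 2 ∧ (u = w ∨ w = u * c)))) := by
  have hne : ¬ (c = d ∧ u = w) := by
    rintro ⟨rfl, rfl⟩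
    rw [union_self, card_prog u hc] at h
    omega
  have himg : ∀ x e : G, univ.image (fun i : Fin (n + 1) => x * e ^ (i : ℕ)) =
      prog x e (n + 1) := by
    intro x e
    ext g
    simp only [mem_image, mem_univ, true_and, mem_prog]
    exact ⟨fun ⟨i, hi⟩ => ⟨i, i.2, hi⟩, fun ⟨i, hi, h⟩ => ⟨⟨i, hi⟩, h⟩⟩
  have hmono : ∀ x e : G, 1 < e → StrictMono fun i : Fin (n + 1) => x * e ^ (i : ℕ) :=
    fun x e he => (strictMono_mul_pow x he).comp Fin.val_strictMono
  obtain ⟨p, q, hpq⟩ := exists_succAbove_eq (hmono u c hc) (hmono w d hd)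
    (by rw [himg, himg]; exact h)
  have hpq' : ∀ i < n, u * c ^ (if i < (p : ℕ) then i else i + 1) =
      w * d ^ (if i < (q : ℕ) then i else i + 1) := by
    intro i hi
    have := hpq ⟨i, hi⟩
    simpa only [succAbove_val] using this
  clear hpq
  obtain ⟨p, hp⟩ := p
  obtain ⟨q, hq⟩ := q
  simp only at hpq'
  have step : ∀ {i j k l : ℕ}, u * c ^ i = w * d ^ k → u * c ^ (i + j) = w * d ^ (k + l) →
      c ^ j = d ^ l := by
    intro i j k l h1 h2
    rw [pow_add, pow_add, ← mul_assoc, ← mul_assoc, h1] at h2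
    exact mul_left_cancel h2
  have heq : c = d → (c = d ∧ (w = u * c ∨ u = w * c)) := by
    rintro rfl
    refine ⟨rfl, ?_⟩
    have huw : u ≠ w := fun h => hne ⟨rfl, h⟩
    have hnot : ∀ i, u * c ^ i ≠ w * c ^ i := fun i h => huw (mul_right_cancel h)
    have h0 := hpq' 0 (by omega)
    have hl := hpq' (n - 1) (by omega)
    by_cases hp0 : p = 0 <;> by_cases hq0 : q = 0
    · subst hp0 hq0
      exact absurd h0 (hnot _)
    · subst hp0
      left
      rw [if_neg (by omega), if_pos (by omega)] at h0
      simpa using h0.symm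
    · subst hq0
      right
      rw [if_pos (by omega), if_neg (by omega)] at h0
      simpa using h0
    · rw [if_pos (by omega), if_pos (by omega)] at h0
      exact absurd h0 (hnot _)
  have h0 := hpq' 0 (by omega)
  have h1 := hpq' 1 (by omega)
  -- An omitted index doubles the exponent in at most one of the first two ratios. For `n > 2` two
  -- ratios are compared, and `c = d` follows because `c ^ 2 = d` and `c = d ^ 2` cannot hold
  -- together. For `n = 2` there is a single ratio, and each position of the omitted indices is
  -- examined.
  rcases Nat.lt_or_ge 2 n with hn2 | hn2
  · left
    apply heq
    have h2 := hpq' 2 (by omega)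
    have s0 : c ^ (if p = 1 then 2 else 1) = d ^ (if q = 1 then 2 else 1) := by
      refine step h0 ?_
      convert h1 using 3 <;> split_ifs <;> omega
    have s1 : c ^ (if p = 2 then 2 else 1) = d ^ (if q = 2 then 2 else 1) := by
      refine step h1 ?_
      convert h2 using 3 <;> split_ifs <;> omega
    have inj2 : c ^ 2 = d ^ 2 → c = d := fun h => pow_left_injective two_ne_zero h
    have hno1 : ¬ (c ^ 2 = d ∧ c = d ^ 2) := by
      rintro ⟨rfl, h⟩
      rw [← pow_mul] at h
      have := (pow_right_strictMono' hc).injective (a₁ := 1) (a₂ := 4) (by simpa using h)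
      omega
    have hno2 : ¬ (c = d ^ 2 ∧ c ^ 2 = d) := fun h => hno1 ⟨h.2, h.1⟩
    split_ifs at s0 s1 <;> first | omega | skip
    all_goals simp only [pow_one] at s0 s1
    all_goals first
      | assumption
      | exact inj2 s0
      | exact inj2 s1
      | exact (hno1 (And.intro s0 s1)).elim
      | exact (hno2 (And.intro s0 s1)).elim
  · obtain rfl : n = 2 := by omega
    interval_cases p <;> interval_cases q <;> simp at h0 h1
    · left
      rw [pow_two, pow_two, ← mul_assoc, ← mul_assoc, h0] at h1
      exact heq (mul_left_cancel h1)
    · right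
      refine ⟨rfl, Or.inr ?_⟩
      subst h0
      rw [pow_two, ← mul_assoc] at h1
      exact ⟨mul_left_cancel h1, Or.inr rfl⟩
    · left
      rw [pow_two, ← mul_assoc, h0] at h1
      exact heq (mul_left_cancel h1)
    · right
      refine ⟨rfl, Or.inl ?_⟩
      subst h0
      rw [pow_two d, ← mul_assoc] at h1
      exact ⟨(mul_left_cancel h1).symm, Or.inr rfl⟩
    · left; exact heq (sq_eq_of_mul_sq h0 h1)
    · right
      subst h0
      exact ⟨rfl, Or.inl ⟨(mul_left_cancel h1).symm, Or.inl rfl⟩⟩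
    · left
      rw [pow_two, ← mul_assoc, h0] at h1
      exact heq (mul_left_cancel h1)
    · right
      subst h0
      exact ⟨rfl, Or.inr ⟨mul_left_cancel h1, Or.inl rfl⟩⟩
    · left
      subst h0
      exact heq (mul_left_cancel h1)

/-- The structure of a set `insert y T` with `T` abelian, when it is non-abelian and its square is
as small as possible. -/
theorem exists_prog_of_isAbelian {T : Finset G} {y : G} (hT : IsAbelian T) (h3 : 3 ≤ T.card)
    (hna : ∃ t ∈ T, ¬ Commute t y)
    (hcard : (insert y T * insert y T).card ≤ 3 * T.card + 1) :
    ∃ x c : G, 1 < c ∧ Commute x c ∧ T = prog x c T.card ∧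
      ((Commute c y ∧ (x * y = y * x * c ∨ y * x = x * y * c)) ∨
        (T.card = 3 ∧ ((conj c y = c ^ 2 ∧ (y * x = x * y ∨ y * x = x * y * conj c y)) ∨
          (c = conj c y ^ 2 ∧ (y * x = x * y ∨ x * y = y * x * c))))) := by
  have hlow := two_mul_card_le T ⟨_, hna.choose_spec.1⟩
  obtain ⟨e1, e2⟩ := card_mul_insert_of_isAbelian hT hna
  obtain ⟨x, c, hc, hxc, hTp⟩ := exists_eq_prog hT (by omega) (by omega)
  refine ⟨x, c, hc, hxc, hTp, ?_⟩
  obtain ⟨n, hn⟩ : ∃ n, T.card = n + 1 := ⟨T.card - 1, by omega⟩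
  -- Left translation keeps the ratio `c`; right translation replaces it by its conjugate. The count
  -- forces the union of the two progressions to have `n + 2` elements.
  have hA : {y} * T = prog (y * x) c (n + 1) := by
    rw [← hn]
    conv_lhs => rw [hTp]
    ext g
    simp [prog, mem_mul, mul_assoc]
  have hB : T * {y} = prog (x * y) (conj c y) (n + 1) := by
    rw [← hn]
    conv_lhs => rw [hTp]
    have hpow : ∀ i : ℕ, conj c y ^ i = y⁻¹ * c ^ i * y := by
      intro i
      have := conj_pow (a := y⁻¹) (b := c) (i := i)
      rwa [inv_inv] at this
    ext g
    simp [prog, mem_mul, mul_assoc, hpow]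
  have hd : 1 < conj c y := by
    have := mul_lt_mul_left (mul_lt_mul_right hc y⁻¹) y
    simpa [conj] using this
  have hU : (prog (y * x) c (n + 1) ∪ prog (x * y) (conj c y) (n + 1)).card = n + 2 := by
    rw [← hA, ← hB]; omega
  rcases prog_union_prog hc hd (by omega) hU with ⟨h1, h2⟩ | ⟨rfl, h⟩
  · left
    refine ⟨?_, h2⟩
    rw [conj, mul_assoc] at h1
    exact (eq_inv_mul_iff_mul_eq.mp h1).symm
  · right
    exact ⟨hn, h⟩

end Progressions

/-! ### Quadruples without commuting triples: the case of commuting pairs. -/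

section Quadruples

variable {G : Type*} [Group G]

/-- The form of `{x, x c, x c ^ 2}` with `c ^ x = c ^ 2`. -/
def BSTriple (p q r : G) : Prop := p * r = q * p ∧ r * p = q * r

/-- The form of `{x, c x, c ^ 2 x}` with `(c ^ 2) ^ x = c`. -/
def BSTripleOp (p q r : G) : Prop := r * p = p * q ∧ p * r = r * q

/-- The relations among the three smallest members of a golden quadruple; `HighTriple` records those
among the three largest. -/
def LowTriple (p q r : G) : Prop := p * r = q * p ∧ r * p = q * q

def HighTriple (p q r : G) : Prop := p * r = q * q ∧ r * p = q * r

/-- The form of `{x, x c, x c ^ x, x c ^ (x ^ 2)}` with `c ^ (x ^ 2) = c c ^ x = c ^ x c`. -/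
def GoldenQuad (a b c d : G) : Prop := LowTriple a b c ∧ HighTriple b c d

/-- The image of `GoldenQuad` in the opposite group. -/
def GoldenQuadOp (a b c d : G) : Prop :=
  (c * a = a * b ∧ a * c = b * b) ∧ (d * b = c * c ∧ b * d = d * c)

/-- Two commuting pairs with the same ratio. -/
def PairQuad (a b c d : G) : Prop :=
  ∃ e, b = a * e ∧ d = c * e ∧ Commute a e ∧ Commute c e ∧ (a * c = c * a * e ∨ c * a = a * c * e)

theorem PairQuad.of_inv {a b c d : G} (h : PairQuad a⁻¹ b⁻¹ c⁻¹ d⁻¹) : PairQuad a b c d := by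
  obtain ⟨e, h1, h2, h3, h4, h5⟩ := h
  have h3' : Commute a e := Commute.inv_left_iff.mp h3
  have h4' : Commute c e := Commute.inv_left_iff.mp h4
  refine ⟨e⁻¹, ?_, ?_, h3'.inv_right, h4'.inv_right, ?_⟩
  · rw [← inv_inj, h1, mul_inv_rev, inv_inv, h3.eq]
  · rw [← inv_inj, h2, mul_inv_rev, inv_inv, h4.eq]
  · have comm1 : Commute e (a * c) := h3'.symm.mul_right h4'.symm
    have comm2 : Commute e (c * a) := h4'.symm.mul_right h3'.symm
    rcases h5 with h5 | h5
    · right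
      rw [← comm1.inv_left.eq, ← inv_inj, mul_inv_rev, h5, mul_inv_rev, inv_inv, mul_inv_rev]
    · left
      rw [← comm2.inv_left.eq, ← inv_inj, mul_inv_rev, h5, mul_inv_rev, inv_inv, mul_inv_rev]

variable [LinearOrder G]

/-- Facts about `{a < b < c < d}` when its square has ten elements and no three of its elements
commute pairwise. -/
structure Quad (a b c d : G) : Prop where
  ab : a < b
  bc : b < c
  cd : c < d
  nabc : Commute a b → Commute a c → ¬ Commute b c
  nabd : Commute a b → Commute a d → ¬ Commute b d
  nacd : Commute a c → Commute a d → ¬ Commute c d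
  nbcd : Commute b c → Commute b d → ¬ Commute c d
  ad : a * d = b * b ∨ a * d = b * c ∨ a * d = c * b ∨ a * d = c * c
  da : d * a = b * b ∨ d * a = c * b ∨ d * a = b * c ∨ d * a = c * c
  cd_comm : Commute c d → Commute b c ∨ Commute b d ∨ b * c = d * b ∨ c * b = b * d
  ab_comm : Commute a b → Commute b c ∨ Commute a c ∨ c * a = b * c ∨ a * c = c * b
  cd_ncomm : ¬ Commute c d → ¬ Commute b c ∧ (b * d = c * b ∨ b * d = c * c ∨ b * d = d * c) ∧
    (d * b = b * c ∨ d * b = c * c ∨ d * b = c * d)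
  ab_ncomm : ¬ Commute a b → ¬ Commute b c ∧ (c * a = b * c ∨ c * a = b * b ∨ c * a = a * b) ∧
    (a * c = c * b ∨ a * c = b * b ∨ a * c = b * a)

variable {a b c d : G}

/-- Every admissible value of `a * d` would commute with `b` or with `c`, which completes a
commuting triple. -/
theorem Quad.not_path (h : Quad a b c d) (hab : Commute a b) (hcd : Commute c d) :
    ¬ Commute b c := by
  intro hbc
  have hac : ¬ Commute a c := fun h' => h.nabc hab h' hbc
  have hbd : ¬ Commute b d := fun h' => h.nbcd hbc h' hcd
  have e1 : Commute b (a * d) → False := fun h' => hbd (commute_of_mul_left hab.symm h')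
  have e2 : Commute c (a * d) → False := fun h' => hac (commute_of_mul_right hcd h').symm
  rcases h.ad with h1 | h1 | h1 | h1 <;> rw [h1] at e1 e2
  · exact e1 ((Commute.refl b).mul_right (Commute.refl b))
  · exact e1 ((Commute.refl b).mul_right hbc)
  · exact e1 (hbc.mul_right (Commute.refl b))
  · exact e2 ((Commute.refl c).mul_right (Commute.refl c))

/-- An element commuting with its two neighbours on one side commutes with the opposite one. -/
theorem Quad.commute_ad (h : Quad a b c d) (hab : Commute a b) (hac : Commute a c) :
    Commute a d := by
  apply commute_of_mul_left (Commute.refl a)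
  rcases h.ad with h1 | h1 | h1 | h1 <;> rw [h1]
  exacts [hab.mul_right hab, hab.mul_right hac, hac.mul_right hab, hac.mul_right hac]

variable [MulLeftMono G] [MulRightMono G]

/-- Inverting and dualizing the order keeps the positions and interchanges the two products of each
pair, so one of two mirror cases suffices. -/
theorem Quad.op {a b c d : G} (h : Quad a b c d) :
    @Quad G _ (OrderDual.instLinearOrder G) a⁻¹ b⁻¹ c⁻¹ d⁻¹ := by
  have h1 : b⁻¹ < a⁻¹ := inv_lt_inv_iff.mpr h.ab
  have h2 : c⁻¹ < b⁻¹ := inv_lt_inv_iff.mpr h.bc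
  have h3 : d⁻¹ < c⁻¹ := inv_lt_inv_iff.mpr h.cd
  refine @Quad.mk G _ (OrderDual.instLinearOrder G) _ _ _ _ h1 h2 h3
    ?_ ?_ ?_ ?_ ?_ ?_ ?_ ?_ ?_ ?_ <;>
    simp only [Commute.inv_inv_iff, ← mul_inv_rev, inv_inj]
  · exact h.nabc
  · exact h.nabd
  · exact h.nacd
  · exact h.nbcd
  · exact h.da
  · exact h.ad
  · have := h.cd_comm
    tauto
  · have := h.ab_comm
    tauto
  · have := h.cd_ncomm
    tauto
  · have := h.ab_ncomm
    tauto

/-- Inversion with the order kept exchanges the two ends of the quadruple. -/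
theorem Quad.rev {a b c d : G} (h : Quad a b c d) : Quad d⁻¹ c⁻¹ b⁻¹ a⁻¹ where
  ab := inv_lt_inv_iff.mpr h.cd
  bc := inv_lt_inv_iff.mpr h.bc
  cd := inv_lt_inv_iff.mpr h.ab
  nabc h1 h2 h3 := h.nbcd (Commute.inv_inv_iff.mp h3.symm) (Commute.inv_inv_iff.mp h2.symm)
    (Commute.inv_inv_iff.mp h1.symm)
  nabd h1 h2 h3 := h.nacd (Commute.inv_inv_iff.mp h3.symm) (Commute.inv_inv_iff.mp h2.symm)
    (Commute.inv_inv_iff.mp h1.symm)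
  nacd h1 h2 h3 := h.nabd (Commute.inv_inv_iff.mp h3.symm) (Commute.inv_inv_iff.mp h2.symm)
    (Commute.inv_inv_iff.mp h1.symm)
  nbcd h1 h2 h3 := h.nabc (Commute.inv_inv_iff.mp h3.symm) (Commute.inv_inv_iff.mp h2.symm)
    (Commute.inv_inv_iff.mp h1.symm)
  ad := by
    have := h.ad
    simp only [← mul_inv_rev, inv_inj]
    tauto
  da := by
    have := h.da
    simp only [← mul_inv_rev, inv_inj]
    tauto
  cd_comm := by
    have := h.ab_comm
    simp only [Commute.inv_inv_iff, ← mul_inv_rev, inv_inj]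
    rw [Commute.symm_iff (a := b) (b := a), Commute.symm_iff (a := c) (b := a),
      Commute.symm_iff (a := c) (b := b), eq_comm (a := c * b), eq_comm (a := b * c)] at *
    tauto
  ab_comm := by
    have := h.cd_comm
    simp only [Commute.inv_inv_iff, ← mul_inv_rev, inv_inj]
    rw [Commute.symm_iff (a := d) (b := c), Commute.symm_iff (a := c) (b := b),
      Commute.symm_iff (a := d) (b := b), eq_comm (a := d * b), eq_comm (a := b * d)]
    tauto
  cd_ncomm := by
    have := h.ab_ncomm
    simp only [Commute.inv_inv_iff, ← mul_inv_rev, inv_inj]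
    rw [Commute.symm_iff (a := b) (b := a), Commute.symm_iff (a := c) (b := b)]
    tauto
  ab_ncomm := by
    have := h.cd_ncomm
    simp only [Commute.inv_inv_iff, ← mul_inv_rev, inv_inj]
    rw [Commute.symm_iff (a := d) (b := c), Commute.symm_iff (a := c) (b := b)]
    tauto

/-- The only surviving value is `a * d = b * c`. With `b = a * e` it gives `d = e * c`, and `e`
commutes with `a` and `c`. The alternative `c * b = b * d` would give `e ^ 2 = 1`, hence `a = b`. -/
theorem Quad.pairQuad_aux (h : Quad a b c d) (hab : Commute a b) (hcd : Commute c d)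
    (hbc : ¬ Commute b c) (hac : ¬ Commute a c) (hbd : ¬ Commute b d) (hP : a * c = c * b) :
    PairQuad a b c d := by
  have hq : b * c = d * b ∨ c * b = b * d := by
    have := h.cd_comm hcd
    tauto
  have had : a * d = b * c := by
    rcases h.ad with h1 | h1 | h1 | h1
    · refine absurd (commute_of_mul_left hab.symm ?_) hbd
      rw [h1]
      exact (Commute.refl b).mul_right (Commute.refl b)
    · exact h1
    · exact absurd (mul_left_cancel (h1.trans hP.symm)) h.cd.ne'
    · refine absurd (commute_of_mul_right hcd ?_).symm hac
      rw [h1]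
      exact (Commute.refl c).mul_right (Commute.refl c)
  obtain ⟨e, rfl⟩ : ∃ e, b = a * e := ⟨a⁻¹ * b, by group⟩
  have hae : Commute a e := commute_of_mul_left (Commute.refl a) hab
  have hd : d = e * c := by rw [mul_assoc] at had; exact mul_left_cancel had
  subst hd
  have hce : Commute c e := commute_of_mul_right (Commute.refl c) hcd
  rcases hq with hq | hq
  · exact ⟨e, rfl, hce.eq.symm, hae, hce, Or.inl (by rw [hP, mul_assoc])⟩
  · exfalso
    have h1 : a * c * (e * e) = a * c := by
      have h0 : a * c = a * e * (e * c) := hP.trans hq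
      rw [mul_assoc a e, ← hce.eq, ← mul_assoc e c e, ← hce.eq] at h0
      rw [← mul_assoc, mul_assoc a c e, mul_assoc a (c * e) e]
      exact h0.symm
    have h2 : e = 1 := by
      have : e ^ 2 = 1 ^ 2 := by
        rw [one_pow, pow_two]; exact mul_eq_left.mp h1
      exact pow_left_injective two_ne_zero this
    exact h.ab.ne (by rw [h2, mul_one])

theorem Quad.pairQuad (h : Quad a b c d) (hab : Commute a b) (hcd : Commute c d) :
    PairQuad a b c d := by
  have hbc := h.not_path hab hcd
  have hac : ¬ Commute a c := fun h' => h.nacd h' (h.commute_ad hab h') hcd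
  have hbd : ¬ Commute b d := by
    intro h'
    have := h.rev.commute_ad hcd.symm.inv_inv h'.symm.inv_inv
    exact h.nabd hab (Commute.inv_inv_iff.mp this.symm) h'
  rcases h.ab_comm hab with h1 | h1 | h1 | h1
  · exact absurd h1 hbc
  · exact absurd h1 hac
  · refine PairQuad.of_inv ?_
    refine @Quad.pairQuad_aux G _ (OrderDual.instLinearOrder G) _ _ _ _
      (inferInstanceAs (MulLeftMono Gᵒᵈ)) (inferInstanceAs (MulRightMono Gᵒᵈ)) h.op
      hab.inv_inv hcd.inv_inv ?_ ?_ ?_ ?_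
    · rwa [Commute.inv_inv_iff]
    · rwa [Commute.inv_inv_iff]
    · rwa [Commute.inv_inv_iff]
    · rw [← mul_inv_rev, h1, mul_inv_rev]
  · exact h.pairQuad_aux hab hcd hbc hac hbd h1

theorem Quad.not_commute_bd (h : Quad a b c d) (hcd : ¬ Commute c d) : ¬ Commute b d := by
  intro hbd
  obtain ⟨hbc, hf, -⟩ := h.cd_ncomm hcd
  have h1 : Commute b (b * d) := (Commute.refl b).mul_right hbd
  rcases hf with hf | hf | hf <;> rw [hf] at h1
  · exact hbc (commute_of_mul_right (Commute.refl b) h1)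
  · exact hbc (commute_of_commute_mul_self h1)
  · exact hbc (commute_of_mul_left hbd h1)

/-- Here `a` commutes with all the others. Multiplying the possible equations for `b * d` and `d *
b` by `a` and substituting `a * d = b * c` leaves relations in which cancellation contradicts the
order or a noncommutation. -/
theorem Quad.not_commute_ac_aux (h : Quad a b c d) (hab : Commute a b) (hac : Commute a c)
    (had : Commute a d) (hcd : ¬ Commute c d) (hbd' : ¬ Commute b d) (e : a * d = b * c) :
    False := by
  obtain ⟨hbc, hbd, hdb⟩ := h.cd_ncomm hcd
  have E1 : a * (b * d) = b * b * c := by rw [← mul_assoc, hab.eq, mul_assoc, e, mul_assoc]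
  have E2 : a * (d * b) = b * c * b := by rw [← mul_assoc, e]
  rcases hbd with hbd | hbd | hbd
  · rw [hbd, ← mul_assoc] at E1
    have E3 : a * (b * c * b) = b * b * b * c := by
      rw [mul_assoc b, ← mul_assoc a b, hab.eq, mul_assoc b a, ← mul_assoc a c, E1]
      simp only [mul_assoc]
    rcases hdb with hdb | hdb | hdb
    · rw [← e, had.eq] at hdb
      exact h.ab.ne' (mul_left_cancel hdb)
    · rw [hdb] at E2
      rw [← E2, ← mul_assoc, ← mul_assoc] at E3
      have E4 := mul_right_cancel E3
      have : Commute b (a * a * c) := by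
        rw [E4]
        exact ((Commute.refl b).mul_right (Commute.refl b)).mul_right (Commute.refl b)
      exact hbc (commute_of_mul_left (hab.symm.mul_right hab.symm) this)
    · rw [hdb, ← mul_assoc, hac.eq, mul_assoc, e] at E2
      rw [← E2, ← mul_assoc c b c, ← mul_assoc a, ← mul_assoc a, E1, mul_assoc (b * b) c c,
        mul_assoc (b * b) b c] at E3
      exact h.bc.ne' (mul_right_cancel (mul_left_cancel E3))
  · rcases hdb with hdb | hdb | hdb
    · rw [← e, had.eq] at hdb
      exact h.ab.ne' (mul_left_cancel hdb)
    · exact hbd' (hbd.trans hdb.symm)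
    · rw [hbd, ← mul_assoc] at E1
      have E4 := mul_right_cancel E1
      have : Commute b (a * c) := by
        rw [E4]
        exact (Commute.refl b).mul_right (Commute.refl b)
      exact hbc (commute_of_mul_left hab.symm this)
  · rw [hbd, ← mul_assoc, e] at E1
    have E4 := mul_right_cancel E1
    exact h.bc.ne' (mul_left_cancel E4)

theorem Quad.not_commute_ac (h : Quad a b c d) (hab : Commute a b) (hcd : ¬ Commute c d) :
    ¬ Commute a c := by
  intro hac
  have had := h.commute_ad hab hac
  have hbd := h.not_commute_bd hcd
  rcases h.ad with e | e | e | e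
  · refine hbd (commute_of_mul_left hab.symm ?_)
    rw [e]
    exact (Commute.refl b).mul_right (Commute.refl b)
  · exact h.not_commute_ac_aux hab hac had hcd hbd e
  · refine @Quad.not_commute_ac_aux G _ (OrderDual.instLinearOrder G) _ _ _ _
      (inferInstanceAs (MulLeftMono Gᵒᵈ)) (inferInstanceAs (MulRightMono Gᵒᵈ)) h.op
      hab.inv_inv hac.inv_inv had.inv_inv ?_ ?_ ?_
    · rwa [Commute.inv_inv_iff]
    · rwa [Commute.inv_inv_iff]
    · rw [← mul_inv_rev, ← mul_inv_rev, ← had.eq, e]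
  · refine hcd (commute_of_mul_left hac.symm ?_)
    rw [e]
    exact (Commute.refl c).mul_right (Commute.refl c)

/-- The relation `a * c = c * b` is combined with each possible value of `a * d`, `b * d` and `d *
b`; each combination violates the order or makes a noncommuting pair commute. -/
theorem Quad.false_of_mul_eq (h : Quad a b c d) (hab : Commute a b) (hcd : ¬ Commute c d)
    (hbd' : ¬ Commute b d) (hP : a * c = c * b) : False := by
  obtain ⟨hbc, hbd, hdb⟩ := h.cd_ncomm hcd
  have hlt : c * d < d * c ∨ d * c < c * d := by
    rcases lt_trichotomy (c * d) (d * c) with h' | h' | h'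
    exacts [Or.inl h', absurd h' hcd, Or.inr h']
  rcases h.ad with e | e | e | e
  · refine hbd' (commute_of_mul_left hab.symm ?_)
    rw [e]
    exact (Commute.refl b).mul_right (Commute.refl b)
  · have E1 : a * (b * d) = b * b * c := by rw [← mul_assoc, hab.eq, mul_assoc, e, mul_assoc]
    have E2 : d * b = b * c := by
      apply mul_left_cancel (a := a)
      rw [← mul_assoc, e, mul_assoc, ← hP, ← mul_assoc, ← mul_assoc, hab.eq]
    rcases hbd with hbd | hbd | hbd
    · have h1 : b * c < b * d := mul_lt_mul_right h.cd b
      have h2 : c * b < d * b := mul_lt_mul_left h.cd b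
      rw [hbd] at h1
      rw [E2] at h2
      exact lt_asymm h1 h2
    · rw [hbd, ← mul_assoc] at E1
      have E4 := mul_right_cancel E1
      have : Commute b (a * c) := by
        rw [E4]
        exact (Commute.refl b).mul_right (Commute.refl b)
      exact hbc (commute_of_mul_left hab.symm this)
    · rw [hbd, ← mul_assoc, e] at E1
      have E4 := mul_right_cancel E1
      exact h.bc.ne' (mul_left_cancel E4)
  · exact h.cd.ne' (mul_left_cancel (e.trans hP.symm))
  · have h1 : a * d < b * d := mul_lt_mul_left h.ab d
    rcases hbd with hbd | hbd | hbd
    · rw [e, hbd] at h1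
      exact lt_asymm h1 (mul_lt_mul_right h.bc c)
    · rw [e, hbd] at h1
      exact lt_irrefl _ h1
    · rcases hdb with hdb | hdb | hdb
      -- Both `a` and `d` become conjugates in terms of `b` and `c`, and the relations reduce to `c
      -- * (b⁻¹ * a) = b`. As `b` commutes with `b⁻¹ * a`, it would commute with `c`.
      · have hd : d = b * c * b⁻¹ := eq_mul_inv_of_mul_eq hdb
        have E1 : b * c * b⁻¹ = c * b⁻¹ * c := by
          rw [hd] at hbd
          apply mul_left_cancel (a := b)
          rw [hbd]
          group
        have ha : a = c * b * c⁻¹ := eq_mul_inv_of_mul_eq hP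
        have E2 : c * (b⁻¹ * a) = b := by
          calc c * (b⁻¹ * a) = (c * b⁻¹ * c) * b * c⁻¹ := by rw [ha]; group
            _ = b := by rw [← E1]; group
        have h2 : Commute b (b⁻¹ * a) := (Commute.refl b).inv_right.mul_right hab.symm
        refine hbc (commute_of_mul_right h2 ?_)
        rw [E2]
      · have E1 : a * c * c = c * a * c := by
          rw [mul_assoc, ← hdb, ← mul_assoc, e, mul_assoc, ← hP, mul_assoc]
        have E2 := mul_right_cancel E1
        rw [hP] at E2
        exact h.ab.ne' (mul_left_cancel E2)
      · have h2 : b * d < c * d := mul_lt_mul_left h.bc d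
        have h3 : d * b < d * c := mul_lt_mul_right h.bc d
        rw [hbd] at h2
        rw [hdb] at h3
        exact lt_asymm h2 h3

/-- With its reversal this yields a dichotomy: both outer pairs commute, or neither does. -/
theorem Quad.commute_cd (h : Quad a b c d) (hab : Commute a b) : Commute c d := by
  by_contra hcd
  have hbd := h.not_commute_bd hcd
  rcases h.ab_comm hab with h1 | h1 | h1 | h1
  · exact (h.cd_ncomm hcd).1 h1
  · exact h.not_commute_ac hab hcd h1
  · refine @Quad.false_of_mul_eq G _ (OrderDual.instLinearOrder G) _ _ _ _
      (inferInstanceAs (MulLeftMono Gᵒᵈ)) (inferInstanceAs (MulRightMono Gᵒᵈ)) h.op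
      hab.inv_inv ?_ ?_ ?_
    · rwa [Commute.inv_inv_iff]
    · rwa [Commute.inv_inv_iff]
    · rw [← mul_inv_rev, h1, mul_inv_rev]
  · exact h.false_of_mul_eq hab hcd hbd h1

theorem Quad.commute_ab (h : Quad a b c d) (hcd : Commute c d) : Commute a b :=
  (Commute.inv_inv_iff.mp (h.rev.commute_cd hcd.symm.inv_inv)).symm

end Quadruples

/-! ### Quadruples whose outer pairs do not commute. -/

section NoncommutingQuadruples

variable {G : Type*} [Group G]

/-- For `p < q < r` these are the shapes in which the products of neighbours satisfy `p * q < q * p`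
and `q * r < r * q`; the inverted shapes reverse both inequalities. -/
def PlusForm (p q r : G) : Prop := LowTriple p q r ∨ HighTriple p q r ∨ BSTriple p q r

theorem bsTriple_inv {p q r : G} : BSTriple p⁻¹ q⁻¹ r⁻¹ ↔ BSTripleOp p q r := by
  simp only [BSTriple, BSTripleOp, ← mul_inv_rev, inv_inj]

theorem goldenQuad_inv {a b c d : G} : GoldenQuad a⁻¹ b⁻¹ c⁻¹ d⁻¹ ↔ GoldenQuadOp a b c d := by
  simp only [GoldenQuad, GoldenQuadOp, LowTriple, HighTriple, ← mul_inv_rev, inv_inj]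

/-- The rewriting rule that moves all factors `x` to the left of the factors `u`. -/
theorem mul_mul_of_bs {x u : G} (h : u * x = x * (u * u)) (z : G) :
    u * (x * z) = x * (u * (u * z)) := by
  rw [← mul_assoc, h]; simp only [mul_assoc]

/-- Both elements after the first in `BSTriple` in terms of the first one and a ratio. -/
theorem BSTriple.exists_ratio {p q r : G} (h : BSTriple p q r) :
    ∃ u, q = p * u ∧ r = p * (u * u) ∧ u * p = p * (u * u) := by
  obtain ⟨h1, h2⟩ := h
  obtain ⟨u, rfl⟩ : ∃ u, q = p * u := ⟨p⁻¹ * q, by group⟩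
  rw [mul_assoc] at h1
  have hr := mul_left_cancel h1
  subst hr
  have hup : u * p = p * (u * u) := by
    apply mul_right_cancel (b := p)
    rw [h2]
    simp only [mul_assoc]
  exact ⟨u, rfl, hup, hup⟩

/-- This and the next three lemmas exclude overlaps of a squaring triple with half of a golden
quadruple: expressed through the ratio `u` of the squaring triple, the relations collapse to `u =
1`. -/
theorem LowTriple.eq_of_bsTriple {a b c d : G} (h : LowTriple a b c) (h' : BSTriple b c d) :
    b = c := by
  obtain ⟨h1, h2⟩ := h
  obtain ⟨u, rfl, rfl, hu⟩ := h'.exists_ratio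
  have hua : u * a = b := by rw [mul_assoc] at h2; exact mul_left_cancel h2
  have e : b * (u * b) = b * (b * u) := by
    calc b * (u * b) = b * (u * (u * a)) := by rw [hua]
      _ = (u * b) * a := by rw [hu]; simp only [mul_assoc]
      _ = b * (b * u) := by rw [mul_assoc, ← h1, ← mul_assoc, hua]
  have := mul_left_cancel e
  rw [hu, mul_right_inj, mul_eq_left] at this
  rw [this, mul_one]

theorem HighTriple.eq_of_bsTriple {a b c d : G} (h : HighTriple a b c) (h' : BSTriple b c d) :
    b = c := by
  obtain ⟨h1, h2⟩ := h
  obtain ⟨u, rfl, rfl, hu⟩ := h'.exists_ratio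
  have hua : u * a = b * u := by rw [mul_assoc] at h2; exact mul_left_cancel h2
  have e : u * (a * (b * u)) = u * (b * b) := by rw [h1]
  rw [← mul_assoc, hua] at e
  simp only [mul_assoc, hu, mul_mul_of_bs hu, mul_right_inj] at e
  rw [left_eq_mul] at e
  rw [e, mul_one]

theorem BSTriple.eq_of_lowTriple {a b c d : G} (h : BSTriple a b c) (h' : LowTriple b c d) :
    a = b := by
  obtain ⟨h1, h2⟩ := h'
  obtain ⟨u, rfl, rfl, hu⟩ := h.exists_ratio
  have e : a * (u * u) * (a * u) * (a * u) = a * u * (a * (u * u) * (a * (u * u))) := by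
    rw [← h1, mul_assoc, h2]
  simp only [mul_assoc, mul_mul_of_bs hu, mul_right_inj] at e
  rw [mul_eq_left] at e
  rw [e, mul_one]

theorem BSTriple.eq_of_highTriple {a b c d : G} (h : BSTriple a b c) (h' : HighTriple b c d) :
    a = b := by
  obtain ⟨h1, h2⟩ := h'
  obtain ⟨u, rfl, rfl, hu⟩ := h.exists_ratio
  have hd : d = u * (a * (u * u)) := by
    apply mul_left_cancel (a := a * u)
    rw [h1]
    simp only [mul_assoc]
  rw [hd] at h2
  simp only [mul_assoc, mul_mul_of_bs hu, mul_right_inj] at h2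
  rw [mul_eq_left] at h2
  rw [h2, mul_one]

variable [LinearOrder G] [MulLeftMono G] [MulRightMono G] 

/-- Of the nine combinations, two contradict the order and one makes `p` commute with `r` and so
with `q`. The other six are the three shapes and their inverses. -/
theorem plusForm_or_plusForm_inv {p q r : G} (hpq : p < q) (hqr : q < r) (hnc : ¬ Commute p q)
    (h1 : p * r = q * p ∨ p * r = q * q ∨ p * r = r * q)
    (h2 : r * p = p * q ∨ r * p = q * q ∨ r * p = q * r) :
    PlusForm p q r ∨ PlusForm p⁻¹ q⁻¹ r⁻¹ := by
  have l1 : p * q < p * r := mul_lt_mul_right hqr p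
  have l2 : q * p < r * p := mul_lt_mul_left hqr p
  have l3 : p * r < q * r := mul_lt_mul_left hpq r
  have l4 : r * p < r * q := mul_lt_mul_right hpq r
  simp only [PlusForm, LowTriple, HighTriple, BSTriple, ← mul_inv_rev, inv_inj]
  rcases h1 with h1 | h1 | h1 <;> rcases h2 with h2 | h2 | h2
  · rw [h1] at l1
    rw [h2] at l2
    exact absurd l1 l2.not_gt
  · tauto
  · tauto
  · tauto
  · have hc : Commute p r := h1.trans h2.symm
    refine absurd (commute_of_commute_mul_self ?_) hnc
    rw [← h1]
    exact (Commute.refl p).mul_right hc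
  · tauto
  · tauto
  · tauto
  · rw [h1] at l3
    rw [h2] at l4
    exact absurd l3 l4.not_gt

theorem PlusForm.lt {p q r : G} (hpq : p < q) (hqr : q < r) (h : PlusForm p q r) :
    p * q < q * p ∧ q * r < r * q := by
  have l1 : p * q < p * r := mul_lt_mul_right hqr p
  have l4 : r * p < r * q := mul_lt_mul_right hpq r
  rcases h with ⟨h1, h2⟩ | ⟨h1, h2⟩ | ⟨h1, h2⟩
  · refine ⟨h1 ▸ l1, ?_⟩
    have : q * r * p < r * q * p := by
      rw [mul_assoc, h2, mul_assoc r, ← h1, ← mul_assoc r, h2, mul_assoc]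
      exact mul_lt_mul_right (mul_lt_mul_right hqr q) q
    exact lt_of_mul_lt_mul_right' this
  · refine ⟨?_, h2 ▸ l4⟩
    have : p * q * r < q * p * r := by
      rw [mul_assoc, ← h2, ← mul_assoc, h1, mul_assoc q p, h1, mul_assoc]
      exact mul_lt_mul_right (mul_lt_mul_right hpq q) q
    exact lt_of_mul_lt_mul_right' this
  · exact ⟨h1 ▸ l1, h2 ▸ l4⟩

theorem PlusForm.lt_of_inv {p q r : G} (hpq : p < q) (hqr : q < r)
    (h : PlusForm p⁻¹ q⁻¹ r⁻¹) : q * p < p * q ∧ r * q < q * r := by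
  have := @PlusForm.lt G _ (OrderDual.instLinearOrder G)
      (inferInstanceAs (MulLeftMono Gᵒᵈ)) (inferInstanceAs (MulRightMono Gᵒᵈ)) p⁻¹ q⁻¹ r⁻¹
      (show q⁻¹ < p⁻¹ from inv_lt_inv_iff.mpr hpq) (show r⁻¹ < q⁻¹ from inv_lt_inv_iff.mpr hqr) h
  have h1 : q⁻¹ * p⁻¹ < p⁻¹ * q⁻¹ := this.1
  have h2 : r⁻¹ * q⁻¹ < q⁻¹ * r⁻¹ := this.2
  rw [← mul_inv_rev, ← mul_inv_rev, inv_lt_inv_iff] at h1 h2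
  exact ⟨h1, h2⟩

variable {a b c d : G}

/-- Overlaps of a squaring triple with another shape are already excluded. Two low triples, two high
triples, or a high one followed by a low one place `a * d` or `d * a` strictly between or beyond its
admissible values. -/
theorem Quad.of_plusForm (h : Quad a b c d) (h1 : PlusForm a b c) (h2 : PlusForm b c d) :
    (BSTriple a b c ∧ BSTriple b c d) ∨ GoldenQuad a b c d := by
  obtain ⟨l1, l2⟩ := h1.lt h.ab h.bc
  obtain ⟨-, l3⟩ := h2.lt h.bc h.cd
  have m1 : b * b < b * c := mul_lt_mul_right h.bc b
  have m2 : c * b < c * c := mul_lt_mul_right h.bc c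
  rcases h1 with h1 | h1 | h1 <;> rcases h2 with h2 | h2 | h2
  · exfalso
    have : c * (a * d) < c * (b * b) := by
      rw [← mul_assoc, h1.2, mul_assoc, h2.1, ← mul_assoc, ← mul_assoc]
      exact mul_lt_mul_left l2 b
    have := lt_of_mul_lt_mul_left' this
    rcases h.ad with e | e | e | e <;> rw [e] at this
    · exact lt_irrefl _ this
    · exact lt_asymm this m1
    · exact lt_asymm this (m1.trans l2)
    · exact lt_asymm this (m1.trans (l2.trans m2))
  · exact Or.inr ⟨h1, h2⟩
  · exact absurd (h1.eq_of_bsTriple h2) h.bc.ne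
  · exfalso
    have k1 : a * d < b * c := by
      have : c * (a * d) < c * (b * c) := by
        rw [← mul_assoc, h1.2, ← mul_assoc c b c, ← h2.1, mul_assoc, mul_assoc]
        exact mul_lt_mul_right l3 b
      exact lt_of_mul_lt_mul_left' this
    have k2 : b * b < a * d := by
      rw [← h1.1]
      exact mul_lt_mul_right h.cd a
    rcases h.ad with e | e | e | e <;> rw [e] at k1 k2
    · exact lt_irrefl _ k2
    · exact lt_irrefl _ k1
    · exact lt_asymm k1 l2
    · exact lt_asymm k1 (l2.trans m2)
  · exfalso
    have : b * (c * c) < b * (d * a) := by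
      rw [← mul_assoc b d a, h2.1, mul_assoc c c a, h1.2, ← mul_assoc, ← mul_assoc]
      exact mul_lt_mul_left l2 c
    have := lt_of_mul_lt_mul_left' this
    rcases h.da with e | e | e | e <;> rw [e] at this
    · exact lt_asymm this (m1.trans (l2.trans m2))
    · exact lt_asymm this m2
    · exact lt_asymm this (l2.trans m2)
    · exact lt_irrefl _ this
  · exact absurd (h1.eq_of_bsTriple h2) h.bc.ne
  · exact absurd (h1.eq_of_lowTriple h2) h.ab.ne
  · exact absurd (h1.eq_of_highTriple h2) h.ab.ne
  · exact Or.inl ⟨h1, h2⟩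

/-- The classification of the quadruples without commuting triples. -/
theorem Quad.classification (h : Quad a b c d) :
    PairQuad a b c d ∨ (BSTriple a b c ∧ BSTriple b c d) ∨
      (BSTripleOp a b c ∧ BSTripleOp b c d) ∨ GoldenQuad a b c d ∨ GoldenQuadOp a b c d := by
  by_cases hab : Commute a b
  · exact Or.inl (h.pairQuad hab (h.commute_cd hab))
  have hcd : ¬ Commute c d := fun h' => hab (h.commute_ab h')
  right
  have or3 : ∀ {A B C : Prop}, A ∨ B ∨ C → C ∨ B ∨ A := by
    rintro A B C (h | h | h)
    exacts [Or.inr (Or.inr h), Or.inr (Or.inl h), Or.inl h]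
  obtain ⟨hbc, f1, f2⟩ := h.ab_ncomm hab
  obtain ⟨-, f3, f4⟩ := h.cd_ncomm hcd
  have k1 := plusForm_or_plusForm_inv h.ab h.bc hab (or3 f2) (or3 f1)
  have k2 := plusForm_or_plusForm_inv h.bc h.cd hbc f3 f4
  rcases k1 with k1 | k1 <;> rcases k2 with k2 | k2
  · rcases h.of_plusForm k1 k2 with h' | h'
    exacts [Or.inl h', Or.inr (Or.inr (Or.inl h'))]
  · exact absurd (k1.lt h.ab h.bc).2 (k2.lt_of_inv h.bc h.cd).1.not_gt
  · exact absurd (k2.lt h.bc h.cd).1 (k1.lt_of_inv h.ab h.bc).2.not_gt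
  · have := @Quad.of_plusForm G _ (OrderDual.instLinearOrder G)
      (inferInstanceAs (MulLeftMono Gᵒᵈ)) (inferInstanceAs (MulRightMono Gᵒᵈ)) _ _ _ _ h.op k1 k2
    rw [bsTriple_inv, bsTriple_inv, goldenQuad_inv] at this
    rcases this with h' | h'
    exacts [Or.inr (Or.inl h'), Or.inr (Or.inr (Or.inr h'))]

end NoncommutingQuadruples

/-! ### From ten products to equations. -/

section FourElements

open Finset

variable {G : Type*} [Group G] [LinearOrder G]

/-- A four-element set with at most ten products and no commuting triple. -/
structure SmallQuad (a b c d : G) : Prop where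
  ab : a < b
  bc : b < c
  cd : c < d
  nabc : Commute a b → Commute a c → ¬ Commute b c
  nabd : Commute a b → Commute a d → ¬ Commute b d
  nacd : Commute a c → Commute a d → ¬ Commute c d
  nbcd : Commute b c → Commute b d → ¬ Commute c d
  card_le : (({a, b, c, d} : Finset G) * {a, b, c, d}).card ≤ 10

theorem mem_mul_triple {a b c g : G} : g ∈ ({a, b, c} : Finset G) * {a, b, c} ↔
    (g = a * a ∨ g = a * b ∨ g = a * c) ∨ (g = b * a ∨ g = b * b ∨ g = b * c) ∨
      (g = c * a ∨ g = c * b ∨ g = c * c) := by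
  simp only [mem_mul, mem_insert, mem_singleton, exists_eq_or_imp, exists_eq_left,
    eq_comm (a := g)]

variable [MulLeftMono G] [MulRightMono G] {a b c d : G}

theorem SmallQuad.rev (h : SmallQuad a b c d) : SmallQuad d⁻¹ c⁻¹ b⁻¹ a⁻¹ where
  ab := inv_lt_inv_iff.mpr h.cd
  bc := inv_lt_inv_iff.mpr h.bc
  cd := inv_lt_inv_iff.mpr h.ab
  nabc h1 h2 h3 := h.nbcd (Commute.inv_inv_iff.mp h3.symm) (Commute.inv_inv_iff.mp h2.symm)
    (Commute.inv_inv_iff.mp h1.symm)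
  nabd h1 h2 h3 := h.nacd (Commute.inv_inv_iff.mp h3.symm) (Commute.inv_inv_iff.mp h2.symm)
    (Commute.inv_inv_iff.mp h1.symm)
  nacd h1 h2 h3 := h.nabd (Commute.inv_inv_iff.mp h3.symm) (Commute.inv_inv_iff.mp h2.symm)
    (Commute.inv_inv_iff.mp h1.symm)
  nbcd h1 h2 h3 := h.nabc (Commute.inv_inv_iff.mp h3.symm) (Commute.inv_inv_iff.mp h2.symm)
    (Commute.inv_inv_iff.mp h1.symm)
  card_le := by
    have : ({d⁻¹, c⁻¹, b⁻¹, a⁻¹} : Finset G) = ({a, b, c, d} : Finset G)⁻¹ := by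
      ext g
      simp only [mem_inv', mem_insert, mem_singleton, inv_eq_iff_eq_inv]
      tauto
    rw [this, ← mul_inv_rev, card_inv]
    exact h.card_le

theorem SmallQuad.card_upper_le (h : SmallQuad a b c d) :
    (({b, c, d} : Finset G) * {b, c, d}).card ≤ 7 := by
  have hlt : ∀ t ∈ ({b, c, d} : Finset G), a < t := by
    simp only [mem_insert, mem_singleton]
    rintro t (rfl | rfl | rfl)
    exacts [h.ab, h.ab.trans h.bc, h.ab.trans (h.bc.trans h.cd)]
  have hna : ¬ IsAbelian (insert a ({b, c, d} : Finset G)) := by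
    intro hA
    exact h.nabc (hA _ (by simp) _ (by simp)) (hA _ (by simp) _ (by simp))
      (hA _ (by simp) _ (by simp))
  have := card_mul_self_add_three_le_of_min hlt hna
  have := h.card_le
  omega

/-- There are exactly three products outside those of the three smallest elements. -/
theorem SmallQuad.products (h : SmallQuad a b c d) :
    (Commute c d → ∀ g ∈ ({a, b, c, d} : Finset G) * {a, b, c, d},
      g ∈ ({a, b, c} : Finset G) * {a, b, c} ∨ g = d * d ∨ g = d * c ∨ g = max (b * d) (d * b)) ∧
    (¬ Commute c d → ∀ g ∈ ({a, b, c, d} : Finset G) * {a, b, c, d},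
      g ∈ ({a, b, c} : Finset G) * {a, b, c} ∨ g = d * d ∨ g = d * c ∨ g = c * d) := by
  have hlt : ∀ t ∈ ({a, b, c} : Finset G), t < d := by
    simp only [mem_insert, mem_singleton]
    rintro t (rfl | rfl | rfl)
    exacts [h.ab.trans (h.bc.trans h.cd), h.bc.trans h.cd, h.cd]
  have hnT : ¬ IsAbelian ({a, b, c} : Finset G) := by
    intro hA
    exact h.nabc (hA _ (by simp) _ (by simp)) (hA _ (by simp) _ (by simp))
      (hA _ (by simp) _ (by simp))
  have hset : ({a, b, c, d} : Finset G) = insert d {a, b, c} := by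
    ext g
    simp only [mem_insert, mem_singleton]
    tauto
  have hna : ¬ IsAbelian (insert d ({a, b, c} : Finset G)) :=
    fun hA => hnT (hA.mono (subset_insert _ _))
  have hcT : ({a, b, c} : Finset G).card = 3 :=
    card_eq_three.mpr ⟨a, b, c, h.ab.ne, (h.ab.trans h.bc).ne, h.bc.ne, rfl⟩
  -- The three smallest elements already have seven products, so a total of ten leaves room for
  -- exactly three more.
  have h7 := three_mul_card_le hnT
  have h10 := h.card_le
  obtain ⟨m, hm, hmax, hcase⟩ := exists_new_products hlt hna
  have hmc : m = c := by
    have h1 := hmax c (by simp)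
    simp only [mem_insert, mem_singleton] at hm
    rcases hm with rfl | rfl | rfl
    · exact absurd h1 (h.ab.trans h.bc).not_ge
    · exact absurd h1 h.bc.not_ge
    · rfl
  subst hmc
  rw [hset] at h10 ⊢
  have hd := mem_insert_self d ({a, b, m} : Finset G)
  have hmS : m ∈ insert d ({a, b, m} : Finset G) := by simp
  have hbS : b ∈ insert d ({a, b, m} : Finset G) := by simp
  have hsub : ({a, b, m} : Finset G) * {a, b, m} ⊆
      insert d ({a, b, m} : Finset G) * insert d ({a, b, m} : Finset G) :=
    mul_subset_mul (subset_insert _ _) (subset_insert _ _)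
  have hdd := mul_self_notMem hlt
  have l1 : d * m < d * d := mul_lt_mul_right h.cd d
  have l2 : m * d < d * d := mul_lt_mul_left h.cd d
  have hdm : d * m ∉ ({a, b, m} : Finset G) * {a, b, m} := by
    intro hg
    obtain ⟨s, hs, t, ht, hst⟩ := mem_mul.mp hg
    exact absurd hst ((mul_le_mul' (hmax _ hs) (hmax _ ht)).trans_lt
      (mul_lt_mul_left h.cd m)).ne
  constructor
  · intro hc g hg
    rcases hcase with ⟨hnc, -, -⟩ | ⟨-, z, hz, hzm, ⟨u, hu, hzu, hnc⟩, hU, hM⟩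
    · exact absurd hc hnc
    have hzb : z = b := by
      simp only [mem_insert, mem_singleton] at hz
      rcases hz with rfl | rfl | rfl
      · exfalso
        have hzd := hlt z (by simp)
        exact h.nbcd (hU b hbS h.ab m hmS hzm) (hU b hbS h.ab d hd hzd) hc
      · rfl
      · exact absurd hzm (lt_irrefl _)
    subst hzb
    have hMS : max (z * d) (d * z) ∈
        insert d ({a, z, m} : Finset G) * insert d ({a, z, m} : Finset G) := by
      rcases max_choice (z * d) (d * z) with e | e <;> rw [e]
      exacts [mul_mem_mul hbS hd, mul_mem_mul hd hbS]
    have hMlt : max (z * d) (d * z) < d * m := by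
      rw [max_lt_iff]
      refine ⟨?_, mul_lt_mul_right hzm d⟩
      rw [← hc.eq]
      exact mul_lt_mul_left hzm d
    exact (card_add_three_le hsub (mul_mem_mul hd hd) (mul_mem_mul hd hmS) hMS hdd hdm hM
      l1.ne' (hMlt.trans l1).ne' hMlt.ne').2 (by omega) g hg
  · intro hnc g hg
    rcases hcase with ⟨-, -, hmd⟩ | ⟨hc, -⟩
    · exact (card_add_three_le hsub (mul_mem_mul hd hd) (mul_mem_mul hd hmS)
        (mul_mem_mul hmS hd) hdd hdm hmd l1.ne' l2.ne' fun e => hnc e.symm).2 (by omega) g hg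
    · exact absurd hc hnc

/-- The upper triple has at most seven products. Once `b` and `c` do not commute, the products other
than `b * d` and `d * b` are already seven, so these two must repeat earlier ones. -/
theorem SmallQuad.cd_ncomm (h : SmallQuad a b c d) (hcd : ¬ Commute c d) :
    ¬ Commute b c ∧ (b * d = c * b ∨ b * d = c * c ∨ b * d = d * c) ∧
      (d * b = b * c ∨ d * b = c * c ∨ d * b = c * d) := by
  have hac := h.ab.trans h.bc
  have hbd := h.bc.trans h.cd
  have bd_lt : b * d < d * d := mul_lt_mul_left hbd d
  have db_lt : d * b < d * d := mul_lt_mul_right hbd d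
  have bd_lt' : b * d < c * d := mul_lt_mul_left h.bc d
  have db_lt' : d * b < d * c := mul_lt_mul_right h.bc d
  have bc_lt : b * c < b * d := mul_lt_mul_right h.cd b
  have cb_lt : c * b < d * b := mul_lt_mul_left h.cd b
  -- If `b` and `c` commuted, `b * d` and `d * b` could only equal `d * c` and `c * d` respectively,
  -- and then `c` would commute with `d * d`.
  have hbc : ¬ Commute b c := by
    intro hbc
    have low : ∀ s ∈ ({a, b, c} : Finset G), ∀ t ∈ ({a, b, c} : Finset G),
        s * t ≤ b * c ∨ s * t = c * c := by
      simp only [mem_insert, mem_singleton]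
      have hab' : a ≤ b := h.ab.le
      have hbc' : b ≤ c := h.bc.le
      have hac' : a ≤ c := hac.le
      rintro s (rfl | rfl | rfl) t (rfl | rfl | rfl)
      · exact Or.inl (mul_le_mul' hab' hac')
      · exact Or.inl (mul_le_mul' hab' hbc')
      · exact Or.inl (mul_le_mul' hab' le_rfl)
      · exact Or.inl (mul_le_mul' le_rfl hac')
      · exact Or.inl (mul_le_mul' le_rfl hbc')
      · exact Or.inl le_rfl
      · rw [hbc.eq]; exact Or.inl (mul_le_mul' le_rfl hab')
      · rw [hbc.eq]; exact Or.inl le_rfl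
      · exact Or.inr rfl
    have e1 : b * d = d * c := by
      rcases h.products.2 hcd (b * d) (mul_mem_mul (by simp) (by simp)) with e | e | e | e
      · obtain ⟨s, hs, t, ht, hst⟩ := mem_mul.mp e
        rcases low s hs t ht with l | l
        · rw [hst] at l
          exact absurd bc_lt l.not_gt
        · refine absurd (commute_of_mul_left hbc.symm ?_) hcd
          rw [← hst, l]
          exact (Commute.refl c).mul_right (Commute.refl c)
      · exact absurd e bd_lt.ne
      · exact e
      · exact absurd e bd_lt'.ne
    have e2 : d * b = c * d := by
      rcases h.products.2 hcd (d * b) (mul_mem_mul (by simp) (by simp)) with e | e | e | e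
      · obtain ⟨s, hs, t, ht, hst⟩ := mem_mul.mp e
        rcases low s hs t ht with l | l
        · rw [hst, hbc.eq] at l
          exact absurd cb_lt l.not_gt
        · refine absurd (commute_of_mul_right hbc.symm ?_) hcd
          rw [← hst, l]
          exact (Commute.refl c).mul_right (Commute.refl c)
      · exact absurd e db_lt.ne
      · exact absurd e db_lt'.ne
      · exact e
    refine hcd (commute_of_commute_mul_self ?_)
    calc c * (d * d) = d * b * d := by rw [e2, mul_assoc]
      _ = d * d * c := by rw [mul_assoc, e1, mul_assoc]
  refine ⟨hbc, ?_⟩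
  have key : ∀ g ∈ ({b, c, d} : Finset G) * {b, c, d},
      g ∈ ({b * b, b * c, c * b, c * c} : Finset G) ∨ g = d * d ∨ g = d * c ∨ g = c * d := by
    have l1 : b * b < b * c := mul_lt_mul_right h.bc b
    have l2 : b * b < c * b := mul_lt_mul_left h.bc b
    have l3 : b * c < c * c := mul_lt_mul_left h.bc c
    have l4 : c * b < c * c := mul_lt_mul_right h.bc c
    have l5 : c * c < c * d := mul_lt_mul_right h.cd c
    have l6 : c * c < d * c := mul_lt_mul_left h.cd c
    have l7 : c * d < d * d := mul_lt_mul_left h.cd d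
    have l8 : d * c < d * d := mul_lt_mul_right h.cd d
    have hle : ∀ g ∈ ({b * b, b * c, c * b, c * c} : Finset G), g ≤ c * c := by
      simp only [mem_insert, mem_singleton]
      rintro g (rfl | rfl | rfl | rfl)
      exacts [(l1.trans l3).le, l3.le, l4.le, le_rfl]
    have hc4 : ({b * b, b * c, c * b, c * c} : Finset G).card = 4 := by
      rw [card_insert_of_notMem, card_insert_of_notMem, card_insert_of_notMem, card_singleton]
      · simp [l4.ne]
      · simp only [mem_insert, mem_singleton, not_or]
        exact ⟨hbc, l3.ne⟩
      · simp only [mem_insert, mem_singleton, not_or]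
        exact ⟨l1.ne, l2.ne, (l1.trans l3).ne⟩
    refine (card_add_three_le (A := {b * b, b * c, c * b, c * c}) ?_ (mul_mem_mul (by simp)
      (by simp)) (mul_mem_mul (by simp) (by simp)) (mul_mem_mul (by simp) (by simp)) ?_ ?_ ?_
      l8.ne' l7.ne' fun e => hcd e.symm).2 (by rw [hc4]; exact h.card_upper_le)
    · simp only [insert_subset_iff, singleton_subset_iff]
      exact ⟨mul_mem_mul (by simp) (by simp), mul_mem_mul (by simp) (by simp),
        mul_mem_mul (by simp) (by simp), mul_mem_mul (by simp) (by simp)⟩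
    · exact fun e => (hle _ e).not_gt (l5.trans l7)
    · exact fun e => (hle _ e).not_gt l6
    · exact fun e => (hle _ e).not_gt l5
  have bb_lt : b * b < b * d := mul_lt_mul_right hbd b
  have bb_lt' : b * b < d * b := mul_lt_mul_left hbd b
  constructor
  · rcases key (b * d) (mul_mem_mul (by simp) (by simp)) with e | e | e | e
    · simp only [mem_insert, mem_singleton] at e
      rcases e with e | e | e | e
      · exact absurd e bb_lt.ne'
      · exact absurd e bc_lt.ne'
      · exact Or.inl e
      · exact Or.inr (Or.inl e)
    · exact absurd e bd_lt.ne
    · exact Or.inr (Or.inr e)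
    · exact absurd e bd_lt'.ne
  · rcases key (d * b) (mul_mem_mul (by simp) (by simp)) with e | e | e | e
    · simp only [mem_insert, mem_singleton] at e
      rcases e with e | e | e | e
      · exact absurd e bb_lt'.ne'
      · exact Or.inl e
      · exact absurd e cb_lt.ne'
      · exact Or.inr (Or.inl e)
    · exact absurd e db_lt.ne
    · exact absurd e db_lt'.ne
    · exact Or.inr (Or.inr e)

/-- Otherwise `b * c`, `b * d`, `c * b`, `d * b` are distinct, and the upper triple has at least `3
+ 4 + 1` products instead of at most seven. -/
theorem SmallQuad.cd_comm (h : SmallQuad a b c d) (hcd : Commute c d) :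
    Commute b c ∨ Commute b d ∨ b * c = d * b ∨ c * b = b * d := by
  by_contra! hcon
  obtain ⟨h1, h2, h3, h4⟩ := hcon
  have hA : IsAbelian ({c, d} : Finset G) :=
    isAbelian_insert (by simp [IsAbelian]) (by simpa using hcd.symm)
  have hcard := card_mul_insert_of_isAbelian (y := b) hA ⟨c, by simp, fun e => h1 e.symm⟩
  have hc2 : ({c, d} : Finset G).card = 2 := card_pair h.cd.ne
  have := two_mul_card_le ({c, d} : Finset G) ⟨c, by simp⟩
  have h7 := h.card_upper_le
  have l1 : b * c < b * d := mul_lt_mul_right h.cd b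
  have l2 : c * b < d * b := mul_lt_mul_left h.cd b
  have h4' : ({b * c, b * d, c * b, d * b} : Finset G).card = 4 := by
    rw [card_insert_of_notMem, card_insert_of_notMem, card_insert_of_notMem, card_singleton]
    · simp [l2.ne]
    · simp only [mem_insert, mem_singleton, not_or]
      exact ⟨h4.symm, h2⟩
    · simp only [mem_insert, mem_singleton, not_or]
      exact ⟨l1.ne, h1, h3⟩
  have hsub : ({b * c, b * d, c * b, d * b} : Finset G) ⊆ {b} * {c, d} ∪ {c, d} * {b} := by
    simp only [insert_subset_iff, singleton_subset_iff, mem_union]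
    exact ⟨Or.inl (mul_mem_mul (by simp) (by simp)), Or.inl (mul_mem_mul (by simp) (by simp)),
      Or.inr (mul_mem_mul (by simp) (by simp)), Or.inr (mul_mem_mul (by simp) (by simp))⟩
  have := card_le_card hsub
  omega

/-- Both products are smaller than each of the new ones they could equal; when `c` and `d` do not
commute, the equations for `b * d` and `d * b` rule out the remaining coincidences. -/
theorem SmallQuad.outer (h : SmallQuad a b c d) :
    a * d ∈ ({a, b, c} : Finset G) * {a, b, c} ∧ d * a ∈ ({a, b, c} : Finset G) * {a, b, c} := by
  have hac := h.ab.trans h.bc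
  have had := hac.trans h.cd
  have l1 : a * d < d * d := mul_lt_mul_left had d
  have l2 : d * a < d * d := mul_lt_mul_right had d
  have l3 : a * d < b * d := mul_lt_mul_left h.ab d
  have l4 : d * a < d * b := mul_lt_mul_right h.ab d
  have l5 : a * d < c * d := mul_lt_mul_left hac d
  have l6 : d * a < d * c := mul_lt_mul_right hac d
  have m1 : a * d ∈ ({a, b, c, d} : Finset G) * {a, b, c, d} :=
    mul_mem_mul (by simp) (by simp)
  have m2 : d * a ∈ ({a, b, c, d} : Finset G) * {a, b, c, d} :=
    mul_mem_mul (by simp) (by simp)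
  by_cases hcd : Commute c d
  · rw [hcd.eq] at l5
    constructor
    · rcases h.products.1 hcd _ m1 with e | e | e | e
      · exact e
      · exact absurd e l1.ne
      · exact absurd e l5.ne
      · exact absurd e (l3.trans_le (le_max_left _ _)).ne
    · rcases h.products.1 hcd _ m2 with e | e | e | e
      · exact e
      · exact absurd e l2.ne
      · exact absurd e l6.ne
      · exact absurd e (l4.trans_le (le_max_right _ _)).ne
  · obtain ⟨-, f1, f2⟩ := h.cd_ncomm hcd
    have k1 : c * b < c * c := mul_lt_mul_right h.bc c
    have k2 : c * c < d * c := mul_lt_mul_left h.cd c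
    have k3 : b * c < c * c := mul_lt_mul_left h.bc c
    have k4 : c * c < c * d := mul_lt_mul_right h.cd c
    constructor
    · rcases h.products.2 hcd _ m1 with e | e | e | e
      · exact e
      · exact absurd e l1.ne
      · rw [e] at l3
        rcases f1 with f | f | f <;> rw [f] at l3
        · exact absurd l3 (k1.trans k2).not_gt
        · exact absurd l3 k2.not_gt
        · exact absurd l3 (lt_irrefl _)
      · exact absurd e l5.ne
    · rcases h.products.2 hcd _ m2 with e | e | e | e
      · exact e
      · exact absurd e l2.ne
      · exact absurd e l6.ne
      · rw [e] at l4
        rcases f2 with f | f | f <;> rw [f] at l4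
        · exact absurd l4 (k3.trans k4).not_gt
        · exact absurd l4 k4.not_gt
        · exact absurd l4 (lt_irrefl _)

theorem SmallQuad.quad (h : SmallQuad a b c d) : Quad a b c d := by
  have hac := h.ab.trans h.bc
  have hbd := h.bc.trans h.cd
  have ha : ∀ {g}, a * d = a * g → d = g := fun e => mul_left_cancel e
  have ha' : ∀ {g}, d * a = g * a → d = g := fun e => mul_right_cancel e
  have l1 : b * a < d * b := mul_lt_mul_of_lt_of_lt hbd h.ab
  have l2 : b * a < d * c := mul_lt_mul_of_lt_of_lt hbd hac
  have l3 : c * a < d * b := mul_lt_mul_of_lt_of_lt h.cd h.ab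
  have l4 : c * a < d * c := mul_lt_mul_of_lt_of_lt h.cd hac
  have l5 : a * b < b * d := mul_lt_mul_of_lt_of_lt h.ab hbd
  have l6 : a * b < c * d := mul_lt_mul_of_lt_of_lt hac hbd
  have l7 : a * c < b * d := mul_lt_mul_of_lt_of_lt h.ab h.cd
  have l8 : a * c < c * d := mul_lt_mul_of_lt_of_lt hac h.cd
  have hda := hac.trans h.cd
  have t := h.outer
  have s := h.rev.outer
  simp only [mem_mul_triple, ← mul_inv_rev, inv_inj] at t s
  -- The facts `t` place the outer products in the square of the lower triple, and `s`, from the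
  -- reversed quadruple, in that of the upper triple. Comparing the two lists leaves products of `b`
  -- and `c`.
  obtain ⟨t1, t2⟩ := t
  obtain ⟨s1, s2⟩ := s
  have n1 : a * d ≠ a * a := fun e => hda.ne' (ha e)
  have n2 : a * d ≠ a * b := fun e => hbd.ne' (ha e)
  have n3 : a * d ≠ a * c := fun e => h.cd.ne' (ha e)
  have n4 : d * a ≠ a * a := fun e => hda.ne' (ha' e)
  have n5 : d * a ≠ b * a := fun e => hbd.ne' (ha' e)
  have n6 : d * a ≠ c * a := fun e => h.cd.ne' (ha' e)
  have p1 : a * d ≠ d * d := fun e => hda.ne (mul_right_cancel e)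
  have p2 : a * d ≠ b * d := fun e => h.ab.ne (mul_right_cancel e)
  have p3 : a * d ≠ c * d := fun e => hac.ne (mul_right_cancel e)
  have p4 : d * a ≠ d * d := fun e => hda.ne (mul_left_cancel e)
  have p5 : d * a ≠ d * b := fun e => h.ab.ne (mul_left_cancel e)
  have p6 : d * a ≠ d * c := fun e => hac.ne (mul_left_cancel e)
  refine ⟨h.ab, h.bc, h.cd, h.nabc, h.nabd, h.nacd, h.nbcd, ?_, ?_, h.cd_comm, ?_,
    h.cd_ncomm, ?_⟩
  · have r1 : a * d ≠ b * a → a * d ≠ c * a →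
        a * d = b * b ∨ a * d = b * c ∨ a * d = c * b ∨ a * d = c * c := by
      intro q1 q2
      rcases t1 with (e | e | e) | (e | e | e) | (e | e | e)
      exacts [absurd e n1, absurd e n2, absurd e n3, absurd e q1, Or.inl e, Or.inr (Or.inl e),
        absurd e q2, Or.inr (Or.inr (Or.inl e)), Or.inr (Or.inr (Or.inr e))]
    rcases s1 with (e | e | e) | (e | e | e) | (e | e | e)
    exacts [absurd e p1, absurd e p3, absurd e p2,
      r1 (fun e' => l2.ne (e'.symm.trans e)) fun e' => l4.ne (e'.symm.trans e),
      Or.inr (Or.inr (Or.inr e)), Or.inr (Or.inl e),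
      r1 (fun e' => l1.ne (e'.symm.trans e)) fun e' => l3.ne (e'.symm.trans e),
      Or.inr (Or.inr (Or.inl e)), Or.inl e]
  · have r1 : d * a ≠ a * b → d * a ≠ a * c →
        d * a = b * b ∨ d * a = c * b ∨ d * a = b * c ∨ d * a = c * c := by
      intro q1 q2
      rcases t2 with (e | e | e) | (e | e | e) | (e | e | e)
      exacts [absurd e n4, absurd e q1, absurd e q2, absurd e n5, Or.inl e,
        Or.inr (Or.inr (Or.inl e)), absurd e n6, Or.inr (Or.inl e), Or.inr (Or.inr (Or.inr e))]
    rcases s2 with (e | e | e) | (e | e | e) | (e | e | e)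
    exacts [absurd e p4, r1 (fun e' => l6.ne (e'.symm.trans e)) fun e' => l8.ne (e'.symm.trans e),
      r1 (fun e' => l5.ne (e'.symm.trans e)) fun e' => l7.ne (e'.symm.trans e), absurd e p6,
      Or.inr (Or.inr (Or.inr e)), Or.inr (Or.inr (Or.inl e)), absurd e p5, Or.inr (Or.inl e),
      Or.inl e]
  · intro hab
    have := h.rev.cd_comm hab.symm.inv_inv
    simp only [Commute.inv_inv_iff, ← mul_inv_rev, inv_inj] at this
    rcases this with e | e | e | e
    exacts [Or.inl e.symm, Or.inr (Or.inl e.symm), Or.inr (Or.inr (Or.inl e.symm)),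
      Or.inr (Or.inr (Or.inr e.symm))]
  · intro hab
    have := h.rev.cd_ncomm fun e => hab (Commute.inv_inv_iff.mp e.symm)
    simp only [Commute.inv_inv_iff, ← mul_inv_rev, inv_inj] at this
    exact ⟨fun e => this.1 e.symm, this.2.2, this.2.1⟩

end FourElements

/-! ### Shapes of sequences, and actions by squaring. -/

section Sequences

open Finset

variable {G : Type*} [Group G]

/-- `p`, `q`, `r` are pairwise noncommuting. -/
def Noncommuting (p q r : G) : Prop := ¬ Commute p q ∧ ¬ Commute p r ∧ ¬ Commute q r

theorem noncommuting_inv {p q r : G} : Noncommuting p⁻¹ q⁻¹ r⁻¹ ↔ Noncommuting p q r := by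
  simp only [Noncommuting, Commute.inv_inv_iff]

def AbelianExcept (x : ℕ → G) (k y : ℕ) : Prop :=
  ∀ i < k, ∀ j < k, i ≠ y → j ≠ y → Commute (x i) (x j)

/-- `x 0, …, x (m - 1)` and `x m, …, x (k - 1)` are progressions with the same central ratio,
which is also the commutator of their first elements or its inverse. -/
structure TwoBlocks (x : ℕ → G) (k m : ℕ) (c : G) : Prop where
  two_le : 2 ≤ m
  add_two_le : m + 2 ≤ k
  step : ∀ i, i + 1 < k → i + 1 ≠ m → x (i + 1) = x i * c
  comm_zero : Commute (x 0) c
  comm_mid : Commute (x m) c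
  rel : x 0 * x m = x m * x 0 * c ∨ x m * x 0 = x 0 * x m * c

theorem TwoBlocks.left {x : ℕ → G} {k m : ℕ} {c : G} (h : TwoBlocks x k m c) {i : ℕ}
    (hi : i < m) : x i = x 0 * c ^ i := by
  induction i with
  | zero => simp
  | succ i ih =>
    have := h.add_two_le
    rw [h.step i (by omega) (by omega), ih (by omega), pow_succ, mul_assoc]

theorem TwoBlocks.right {x : ℕ → G} {k m : ℕ} {c : G} (h : TwoBlocks x k m c) {i : ℕ}
    (hi : m + i < k) : x (m + i) = x m * c ^ i := by
  induction i with
  | zero => simp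
  | succ i ih =>
    rw [← add_assoc, h.step (m + i) (by omega) (by omega), ih (by omega), pow_succ, mul_assoc]

theorem commute_mul_pow {z c : G} (h : Commute z c) (i j : ℕ) :
    Commute (z * c ^ i) (z * c ^ j) :=
  ((Commute.refl z).mul_right (h.pow_right j)).mul_left
    ((h.symm.pow_left i).mul_right ((Commute.refl c).pow_pow i j))

theorem TwoBlocks.commute_left {x : ℕ → G} {k m : ℕ} {c : G} (h : TwoBlocks x k m c) {i j : ℕ}
    (hi : i < m) (hj : j < m) : Commute (x i) (x j) := by
  rw [h.left hi, h.left hj]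
  exact commute_mul_pow h.comm_zero i j

theorem TwoBlocks.commute_right {x : ℕ → G} {k m : ℕ} {c : G} (h : TwoBlocks x k m c) {i j : ℕ}
    (hi : m ≤ i) (hik : i < k) (hj : m ≤ j) (hjk : j < k) : Commute (x i) (x j) := by
  obtain ⟨i, rfl⟩ := Nat.exists_eq_add_of_le hi
  obtain ⟨j, rfl⟩ := Nat.exists_eq_add_of_le hj
  rw [h.right hik, h.right hjk]
  exact commute_mul_pow h.comm_mid i j

theorem TwoBlocks.not_commute {x : ℕ → G} {k m : ℕ} {c : G} (h : TwoBlocks x k m c) {i j : ℕ}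
    (hc : c ≠ 1) (hi : i < m) (hj : m ≤ j) (hjk : j < k) : ¬ Commute (x i) (x j) := by
  obtain ⟨j, rfl⟩ := Nat.exists_eq_add_of_le hj
  rw [h.left hi, h.right hjk]
  intro hcom
  have h1 : Commute (x 0 * c ^ i) (x m) :=
    commute_of_mul_right ((h.comm_zero.pow_right j).mul_left ((Commute.refl c).pow_pow i j)) hcom
  have h2 : Commute (x m) (x 0) := commute_of_mul_right (h.comm_mid.pow_right i) h1.symm
  rcases h.rel with e | e
  · rw [h2.eq] at e
    exact hc (mul_eq_left.mp e.symm)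
  · rw [h2.eq] at e
    exact hc (mul_eq_left.mp e.symm)

/-- The possible shapes of an increasing sequence with few products. -/
def Outcome (x : ℕ → G) (k : ℕ) : Prop :=
  ((∃ y < k, AbelianExcept x k y) ∨ (∃ m c, TwoBlocks x k m c)) ∨
    ((∀ i, i + 2 < k → BSTriple (x i) (x (i + 1)) (x (i + 2))) ∨
      (∀ i, i + 2 < k → BSTripleOp (x i) (x (i + 1)) (x (i + 2))) ∨
      (k = 4 ∧ GoldenQuad (x 0) (x 1) (x 2) (x 3)) ∨
      (k = 4 ∧ GoldenQuadOp (x 0) (x 1) (x 2) (x 3)))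

/-- Powers of two elements cannot act on each other by squaring. -/
theorem eq_one_of_conj_sq {X Y : G} (h1 : X * Y = Y * (X * X)) (h2 : Y * X = X * (Y * Y)) :
    X = 1 := by
  have e : X * (Y * (Y * X)) = X * Y := by
    calc X * (Y * (Y * X)) = X * (Y * Y) * X := by simp only [mul_assoc]
      _ = X * Y := by rw [← h2, mul_assoc, h1]
  have e1 : Y * X = 1 := by
    have := mul_left_cancel e
    exact mul_eq_left.mp this
  have e2 : X * Y = 1 := by rw [mul_eq_one_iff_inv_eq] at *; rw [← e1, inv_inv]
  rw [← mul_assoc, e1, one_mul, e2] at h1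
  exact h1.symm

theorem conj_one_sq_aux {c g : G} {n : ℤ} (h : conj c g = c ^ 2) :
    c ^ n * g = g * (c ^ n * c ^ n) := by
  have h1 : (g⁻¹ * c * g⁻¹⁻¹) ^ n = g⁻¹ * c ^ n * g⁻¹⁻¹ := conj_zpow
  rw [inv_inv] at h1
  rw [conj] at h
  rw [h] at h1
  have h2 : (c ^ 2) ^ n = c ^ n * c ^ n := by
    rw [← zpow_natCast, ← zpow_mul, mul_comm, zpow_mul, zpow_natCast, pow_two]
  rw [← h2, h1]
  group

theorem conj_inv_sq {c g : G} (h : c = conj c g ^ 2) : conj c g⁻¹ = c ^ 2 := by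
  have h1 : (g⁻¹ * c * g⁻¹⁻¹) ^ 2 = g⁻¹ * c ^ 2 * g⁻¹⁻¹ := conj_pow
  rw [inv_inv] at h1
  rw [conj, h1] at h
  rw [conj, inv_inv]
  nth_rewrite 1 [h]
  group

/-- Powers of `c` and `e` cannot both act as squaring, or its inverse, on the other element. -/
theorem zpow_eq_one_of_conj {c e : G} {m n : ℤ}
    (h1 : conj c (e ^ m) = c ^ 2 ∨ c = conj c (e ^ m) ^ 2)
    (h2 : conj e (c ^ n) = e ^ 2 ∨ e = conj e (c ^ n) ^ 2) : c ^ n = 1 := by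
  have key : ∀ {m n : ℤ}, conj c (e ^ m) = c ^ 2 → conj e (c ^ n) = e ^ 2 → c ^ n = 1 :=
    fun h1 h2 => eq_one_of_conj_sq (conj_one_sq_aux h1) (conj_one_sq_aux h2)
  rcases h1 with h1 | h1 <;> rcases h2 with h2 | h2
  · exact key h1 h2
  · have := conj_inv_sq h2
    rw [← zpow_neg] at this
    have := key h1 this
    rwa [zpow_neg, inv_eq_one] at this
  · have := conj_inv_sq h1
    rw [← zpow_neg] at this
    exact key this h2
  · have h1' := conj_inv_sq h1
    have h2' := conj_inv_sq h2
    rw [← zpow_neg] at h1' h2'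
    have := key h1' h2'
    rwa [zpow_neg, inv_eq_one] at this

/-- This separates the shapes built from triples from those built from commuting blocks. -/
theorem PlusForm.noncommuting {p q r : G} (hpq : p ≠ q) (hqr : q ≠ r) (h : PlusForm p q r) :
    Noncommuting p q r := by
  have sq : ∀ g : G, Commute g (g * g) := fun g => (Commute.refl g).mul_right (Commute.refl g)
  rcases h with ⟨h1, h2⟩ | ⟨h1, h2⟩ | ⟨h1, h2⟩
  · have hpr : ¬ Commute p r := by
      intro e
      rw [← e.eq, h1] at h2
      exact hpq (mul_left_cancel h2)
    refine ⟨fun e => ?_, hpr, fun e => hpr ?_⟩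
    · rw [← e.eq] at h1
      exact hqr (mul_left_cancel h1).symm
    · have : Commute r (r * p) := by
        rw [h2]; exact e.symm.mul_right e.symm
      exact (commute_of_mul_left (Commute.refl r) this).symm
  · have hpr : ¬ Commute p r := by
      intro e
      rw [← e.eq, h1] at h2
      exact hqr (mul_left_cancel h2)
    refine ⟨fun e => hpr ?_, hpr, fun e => ?_⟩
    · have : Commute p (p * r) := by
        rw [h1]; exact e.mul_right e
      exact commute_of_mul_left (Commute.refl p) this
    · rw [e.eq] at h2
      exact hpq (mul_left_cancel h2)
  · refine ⟨fun e => ?_, fun e => ?_, fun e => ?_⟩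
    · rw [← e.eq] at h1
      exact hqr (mul_left_cancel h1).symm
    · rw [← e.eq, h1] at h2
      have := mul_left_cancel h2
      rw [this] at h1
      exact hpq (this.trans (mul_right_cancel h1))
    · rw [e.eq] at h2
      exact hpq (mul_left_cancel h2)

/-- The finite set of the first `k` members of a sequence. -/
def seqSet {α : Type*} [DecidableEq α] (x : ℕ → α) (k : ℕ) : Finset α := (range k).image x

theorem seqSet_succ {α : Type*} [DecidableEq α] (x : ℕ → α) (k : ℕ) :
    seqSet x (k + 1) = insert (x k) (seqSet x k) := by
  rw [seqSet, range_add_one, image_insert, seqSet]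

theorem mem_seqSet {α : Type*} [DecidableEq α] {x : ℕ → α} {k : ℕ} {g : α} :
    g ∈ seqSet x k ↔ ∃ i < k, x i = g := by
  simp [seqSet]

theorem seqSet_succ' {α : Type*} [DecidableEq α] (x : ℕ → α) (k : ℕ) :
    seqSet x (k + 1) = insert (x 0) (seqSet (fun i => x (i + 1)) k) := by
  ext g
  simp only [mem_insert, mem_seqSet]
  constructor
  · rintro ⟨i, hi, rfl⟩
    rcases i with _ | i
    · exact Or.inl rfl
    · exact Or.inr ⟨i, by omega, rfl⟩
  · rintro (rfl | ⟨i, hi, rfl⟩)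
    · exact ⟨0, by omega, rfl⟩
    · exact ⟨i + 1, by omega, rfl⟩

theorem seqSet_four {α : Type*} [DecidableEq α] (x : ℕ → α) :
    seqSet x 4 = {x 0, x 1, x 2, x 3} := by
  ext g
  simp only [mem_seqSet, mem_insert, mem_singleton]
  constructor
  · rintro ⟨i, hi, rfl⟩
    interval_cases i <;> simp
  · rintro (rfl | rfl | rfl | rfl)
    exacts [⟨0, by omega, rfl⟩, ⟨1, by omega, rfl⟩, ⟨2, by omega, rfl⟩, ⟨3, by omega, rfl⟩]

end Sequences

/-! ### Increasing sequences with one exceptional element. -/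

section IncreasingSequences

open Finset

variable {α : Type*} [LinearOrder α]

def IncreasingBelow (x : ℕ → α) (k : ℕ) : Prop := ∀ i j, i < j → j < k → x i < x j

theorem IncreasingBelow.ne {x : ℕ → α} {k i j : ℕ} (h : IncreasingBelow x k) (hi : i < k)
    (hj : j < k) (hij : i ≠ j) : x i ≠ x j := by
  rcases hij.lt_or_gt with h' | h'
  exacts [(h i j h' hj).ne, (h j i h' hi).ne']

theorem IncreasingBelow.card_image {x : ℕ → α} {k : ℕ} (h : IncreasingBelow x k) {I : Finset ℕ}
    (hI : ∀ i ∈ I, i < k) : (I.image x).card = I.card := by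
  refine card_image_of_injOn fun i hi j hj hij => ?_
  by_contra hne
  exact h.ne (hI i hi) (hI j hj) hne hij

theorem IncreasingBelow.card_seqSet {x : ℕ → α} {k : ℕ} (h : IncreasingBelow x k) :
    (seqSet x k).card = k := by
  rw [seqSet, h.card_image (by simp), card_range]

/-- The members of the sequence other than the one with index `y`. -/
def seqErase (x : ℕ → α) (k y : ℕ) : Finset α := ((range k).erase y).image x

theorem insert_seqErase {x : ℕ → α} {k y : ℕ} (hy : y < k) :
    insert (x y) (seqErase x k y) = seqSet x k := by
  rw [seqErase, ← image_insert, insert_erase (mem_range.mpr hy), seqSet]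

theorem IncreasingBelow.card_seqErase {x : ℕ → α} {k y : ℕ} (h : IncreasingBelow x k)
    (hy : y < k) : (seqErase x k y).card = k - 1 := by
  rw [seqErase, h.card_image, card_erase_of_mem (mem_range.mpr hy), card_range]
  intro i hi
  exact mem_range.mp (mem_of_mem_erase hi)

theorem mem_seqErase {x : ℕ → α} {k y i : ℕ} (hi : i < k) (hiy : i ≠ y) :
    x i ∈ seqErase x k y :=
  mem_image_of_mem _ (mem_erase.mpr ⟨hiy, mem_range.mpr hi⟩)

variable {G : Type*} [Group G]

theorem conj_eq_of_commute {p c g : G} (h : Commute p c) : conj c (p * g) = conj c g := by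
  simp only [conj, mul_inv_rev, mul_assoc]
  rw [← mul_assoc c p g, ← h.eq, mul_assoc, inv_mul_cancel_left]

variable [LinearOrder G]

theorem AbelianExcept.isAbelian {x : ℕ → G} {k y : ℕ} (h : AbelianExcept x k y) :
    IsAbelian (seqErase x k y) := by
  intro a ha b hb
  obtain ⟨i, hi, rfl⟩ := mem_image.mp ha
  obtain ⟨j, hj, rfl⟩ := mem_image.mp hb
  rw [mem_erase, mem_range] at hi hj
  exact h i hi.2 j hj.2 hi.1 hj.1

theorem eq_mul_pow_of_seqSet_eq_prog [MulLeftMono G] {x : ℕ → G} {n : ℕ} {z c : G}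
    (hx : IncreasingBelow x n)
    (hc : 1 < c) (h : seqSet x n = prog z c n) : ∀ i < n, x i = z * c ^ i := by
  intro i hi
  have h1 : StrictMono fun i : Fin n => x i := fun i j hij => hx i j hij j.2
  have h2 : StrictMono fun i : Fin n => z * c ^ (i : ℕ) :=
    (strictMono_mul_pow z hc).comp Fin.val_strictMono
  have h3 : Set.range (fun i : Fin n => x i) = Set.range fun i : Fin n => z * c ^ (i : ℕ) := by
    ext g
    have := Finset.ext_iff.mp h g
    rw [mem_seqSet, mem_prog] at this
    constructor
    · rintro ⟨j, rfl⟩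
      obtain ⟨l, hl, e⟩ := this.mp ⟨j, j.2, rfl⟩
      exact ⟨⟨l, hl⟩, e⟩
    · rintro ⟨j, rfl⟩
      obtain ⟨l, hl, e⟩ := this.mpr ⟨j, j.2, rfl⟩
      exact ⟨⟨l, hl⟩, e⟩
  exact congrFun ((StrictMono.range_inj h1 h2).mp h3) ⟨i, hi⟩

variable [MulLeftMono G] [MulRightMono G]

/-- The shape of a set all of whose elements but one commute. -/
theorem AbelianExcept.exists_prog {x : ℕ → G} {k y : ℕ} (h : AbelianExcept x k y)
    (hx : IncreasingBelow x k) (hk : 4 ≤ k) (hy : y < k) (hna : ¬ IsAbelian (seqSet x k))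
    (hcard : (seqSet x k * seqSet x k).card ≤ 3 * k - 2) :
    ∃ z c : G, 1 < c ∧ Commute z c ∧ seqErase x k y = prog z c (k - 1) ∧
      ((Commute c (x y) ∧ (z * x y = x y * z * c ∨ x y * z = z * x y * c)) ∨
        (k = 4 ∧ ((conj c (x y) = c ^ 2 ∧
            (x y * z = z * x y ∨ x y * z = z * x y * conj c (x y))) ∨
          (c = conj c (x y) ^ 2 ∧ (x y * z = z * x y ∨ z * x y = x y * z * c))))) := by
  have hc := hx.card_seqErase hy
  rw [← insert_seqErase hy] at hna hcard
  obtain ⟨z, c, h1, h2, h3, h4⟩ := exists_prog_of_isAbelian (y := x y) h.isAbelian (by omega)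
    (by
      by_contra! hcon
      exact hna (isAbelian_insert h.isAbelian hcon)) (by omega)
  rw [hc] at h3 h4
  refine ⟨z, c, h1, h2, h3, ?_⟩
  rcases h4 with h4 | ⟨h4, h5⟩
  exacts [Or.inl h4, Or.inr ⟨by omega, h5⟩]

/-- An element commuting with two members of a progression commutes with all of them. -/
theorem commute_of_commute_two {z c g : G} {i j : ℕ} (hij : i < j)
    (hi : Commute g (z * c ^ i)) (hj : Commute g (z * c ^ j)) : Commute g z ∧ Commute g c := by
  obtain ⟨l, rfl⟩ := Nat.exists_eq_add_of_lt hij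
  rw [add_assoc, pow_add, ← mul_assoc] at hj
  have h1 : Commute g c := commute_of_commute_pow (by omega) (commute_of_mul_left hi hj)
  exact ⟨commute_of_mul_right (h1.pow_right i) hi, h1⟩

/-- The commuting members form a progression, so commuting with two of them means commuting with its
first term and its ratio. -/
theorem AbelianExcept.commute_of_two {x : ℕ → G} {k y : ℕ} (h : AbelianExcept x k y)
    (hx : IncreasingBelow x k) (hk : 4 ≤ k) (hy : y < k) (hna : ¬ IsAbelian (seqSet x k))
    (hcard : (seqSet x k * seqSet x k).card ≤ 3 * k - 2) {g : G} {p q : ℕ} (hpq : p ≠ q)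
    (hp : p < k) (hq : q < k) (hpy : p ≠ y) (hqy : q ≠ y) (hgp : Commute g (x p))
    (hgq : Commute g (x q)) {i : ℕ} (hi : i < k) (hiy : i ≠ y) : Commute g (x i) := by
  obtain ⟨z, c, -, -, hP, -⟩ := h.exists_prog hx hk hy hna hcard
  obtain ⟨s, -, hs⟩ := mem_prog.mp (hP ▸ mem_seqErase (x := x) hp hpy)
  obtain ⟨t, -, ht⟩ := mem_prog.mp (hP ▸ mem_seqErase (x := x) hq hqy)
  obtain ⟨l, -, hl⟩ := mem_prog.mp (hP ▸ mem_seqErase (x := x) hi hiy)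
  rw [← hs] at hgp
  rw [← ht] at hgq
  have hst : s ≠ t := by
    rintro rfl
    exact hx.ne hp hq hpq (hs.symm.trans ht)
  have key : Commute g z ∧ Commute g c := by
    rcases hst.lt_or_gt with h' | h'
    exacts [commute_of_commute_two h' hgp hgq, commute_of_commute_two h' hgq hgp]
  rw [← hl]
  exact key.1.mul_right (key.2.pow_right l)

/-- When the exceptional element commutes with one of the others, it acts by squaring. -/
theorem AbelianExcept.conj_sq {x : ℕ → G} {y : ℕ} (h : AbelianExcept x 4 y)
    (hx : IncreasingBelow x 4) (hy : y < 4) (hna : ¬ IsAbelian (seqSet x 4))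
    (hcard : (seqSet x 4 * seqSet x 4).card ≤ 3 * 4 - 2) {p w : ℕ} (hp : p < 4) (hpy : p ≠ y)
    (hw : w < 4) (hwy : w ≠ y) (hpw : p ≠ w) (hcom : Commute (x y) (x p)) :
    ∃ c : G, ∃ n : ℤ, Commute (x p) c ∧ x w = x p * c ^ n ∧ c ^ n ≠ 1 ∧
      (conj c (x y) = c ^ 2 ∨ c = conj c (x y) ^ 2) := by
  obtain ⟨z, c, hc, hzc, hP, hcase⟩ := h.exists_prog hx le_rfl hy hna hcard
  obtain ⟨s, -, hs⟩ := mem_prog.mp (hP ▸ mem_seqErase (x := x) hp hpy)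
  obtain ⟨t, -, ht⟩ := mem_prog.mp (hP ▸ mem_seqErase (x := x) hw hwy)
  have hw' : x w = x p * c ^ ((t : ℤ) - s) := by
    rw [← hs, ← ht, zpow_sub, zpow_natCast, zpow_natCast, mul_assoc,
      (Commute.pow_pow (Commute.refl c) t s).inv_right.eq, mul_inv_cancel_left]
  refine ⟨c, (t : ℤ) - s, ?_, hw', ?_, ?_⟩
  · rw [← hs]
    exact hzc.mul_left ((Commute.refl c).pow_left s)
  · intro e
    rw [e, mul_one] at hw'
    exact hx.ne hp hw hpw hw'.symm
  · rcases hcase with ⟨h1, h2⟩ | ⟨-, h1 | h1⟩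
    · exfalso
      rw [← hs] at hcom
      have h3 : Commute (x y) z := commute_of_mul_right (h1.symm.pow_right s) hcom
      rcases h2 with h2 | h2
      · rw [h3.eq] at h2
        exact hc.ne' (mul_eq_left.mp h2.symm)
      · rw [h3.eq] at h2
        exact hc.ne' (mul_eq_left.mp h2.symm)
    · exact Or.inl h1.1
    · exact Or.inr h1.1

/-- An abelian set cannot be extended on both sides by noncommuting elements. -/
theorem not_isAbelian_of_extend {P : Finset G} {a y : G} (ha : ∀ t ∈ P, a < t)
    (hy : ∀ t ∈ P, t < y) (hna : ¬ IsAbelian (insert a P)) (hna' : ¬ IsAbelian (insert y P))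
    (hcard : (insert y (insert a P) * insert y (insert a P)).card ≤ 3 * P.card + 4)
    (h2 : 3 ≤ P.card) : ¬ IsAbelian P := by
  intro hA
  have hP : P.Nonempty := card_pos.mp (by omega)
  have haP : a ∉ P := fun h => lt_irrefl _ (ha a h)
  have hnc : ∃ t ∈ P, ¬ Commute t y := by
    by_contra! hcon
    exact hna' (isAbelian_insert hA hcon)
  have h3 := three_mul_card_le hna
  rw [card_insert_of_notMem haP] at h3
  have h4 := (card_mul_insert_of_isAbelian hA hnc).2
  obtain ⟨t₀, ht₀, hnc⟩ := hnc
  have hpp : ∀ s ∈ P, ∀ t ∈ P, s * t ∉ {y} * P ∪ P * {y} := by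
    intro s hs t ht hg
    have hcg : Commute t₀ (s * t) := (hA _ ht₀ _ hs).mul_right (hA _ ht₀ _ ht)
    rcases mem_union.mp hg with hg | hg
    · obtain ⟨y', hy', p, hp, e⟩ := mem_mul.mp hg
      rw [mem_singleton] at hy'
      subst hy'
      rw [← e] at hcg
      exact hnc (commute_of_mul_right (hA _ ht₀ _ hp) hcg)
    · obtain ⟨p, hp, y', hy', e⟩ := mem_mul.mp hg
      rw [mem_singleton] at hy'
      subst hy'
      rw [← e] at hcg
      exact hnc (commute_of_mul_left (hA _ ht₀ _ hp) hcg)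
  have hlow : ∀ p ∈ P, ∀ q ∈ P, p * q < y * p ∧ p * q < p * y := by
    intro p hp q hq
    refine ⟨?_, mul_lt_mul_right (hy q hq) p⟩
    rw [(hA p hp q hq).eq]
    exact mul_lt_mul_left (hy q hq) p
  have hsmall : ∀ s ∈ insert a P, ∀ t ∈ insert a P, (s = a ∨ t = a) → ∀ p ∈ P,
      s * t < y * p ∧ s * t < p * y := by
    intro s hs t ht hst p hp
    rw [mem_insert] at hs ht
    have : ∃ q ∈ P, s * t < p * q := by
      rcases hst with rfl | rfl
      · rcases ht with rfl | ht
        · exact ⟨p, hp, mul_lt_mul_of_lt_of_lt (ha p hp) (ha p hp)⟩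
        · exact ⟨t, ht, mul_lt_mul_left (ha p hp) t⟩
      · rcases hs with rfl | hs
        · exact ⟨p, hp, mul_lt_mul_of_lt_of_lt (ha p hp) (ha p hp)⟩
        · refine ⟨s, hs, ?_⟩
          rw [(hA p hp s hs).eq]
          exact mul_lt_mul_right (ha p hp) s
    obtain ⟨q, hq, hlt⟩ := this
    exact ⟨hlt.trans (hlow p hp q hq).1, hlt.trans (hlow p hp q hq).2⟩
  -- Products involving `a` are too small to be mixed products with `y`, and products inside `P` are
  -- separated from those by commutation with `t₀`. The sets have at least `3|P| + 1` and `|P| + 1`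
  -- elements, too many when `|P| ≥ 3`.
  have hdisj : Disjoint (insert a P * insert a P) ({y} * P ∪ P * {y}) := by
    rw [disjoint_left]
    intro g hg hg'
    obtain ⟨s, hs, t, ht, rfl⟩ := mem_mul.mp hg
    by_cases hst : s = a ∨ t = a
    · rcases mem_union.mp hg' with hg' | hg'
      · obtain ⟨y', hy', p, hp, e⟩ := mem_mul.mp hg'
        rw [mem_singleton] at hy'
        subst hy'
        exact absurd e (hsmall s hs t ht hst p hp).1.ne'
      · obtain ⟨p, hp, y', hy', e⟩ := mem_mul.mp hg'
        rw [mem_singleton] at hy'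
        subst hy'
        exact absurd e (hsmall s hs t ht hst p hp).2.ne'
    · rw [not_or] at hst
      exact hpp s (mem_of_mem_insert_of_ne hs hst.1) t (mem_of_mem_insert_of_ne ht hst.2) hg'
  have hsub : insert a P * insert a P ∪ ({y} * P ∪ P * {y}) ⊆
      insert y (insert a P) * insert y (insert a P) := by
    have hPs : P ⊆ insert y (insert a P) := (subset_insert _ _).trans (subset_insert _ _)
    have hys : {y} ⊆ insert y (insert a P) := singleton_subset_iff.mpr (mem_insert_self _ _)
    exact union_subset (mul_subset_mul (subset_insert _ _) (subset_insert _ _))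
      (union_subset (mul_subset_mul hys hPs) (mul_subset_mul hPs hys))
  have h5 := card_le_card hsub
  rw [card_union_of_disjoint hdisj] at h5
  omega

end IncreasingSequences

/-! ### Gluing two overlapping windows. -/

section Classification

open Finset

variable {G : Type*} [Group G]

theorem not_noncommuting_of_blocks {x : ℕ → G} {k i : ℕ}
    (h : (∃ y < k, AbelianExcept x k y) ∨ ∃ m c, TwoBlocks x k m c) (hi : i + 2 < k) :
    ¬ Noncommuting (x i) (x (i + 1)) (x (i + 2)) := by
  rintro ⟨h1, h2, h3⟩
  rcases h with ⟨y, -, h⟩ | ⟨m, c, h⟩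
  · by_cases e1 : i = y
    · exact h3 (h _ (by omega) _ (by omega) (by omega) (by omega))
    by_cases e2 : i + 1 = y
    · exact h2 (h _ (by omega) _ (by omega) (by omega) (by omega))
    · exact h1 (h _ (by omega) _ (by omega) e1 e2)
  · by_cases e : i + 1 < m
    · exact h1 (h.commute_left (by omega) e)
    · exact h3 (h.commute_right (by omega) (by omega) (by omega) (by omega))

/-- Neighbours fail to commute only at the boundary of the blocks, so the boundaries agree; a step
inside the right block, common to both windows, identifies the ratios. -/
theorem twoBlocks_of_twoBlocks {x : ℕ → G} {k m m' : ℕ} {c c' : G}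
    (hc : c ≠ 1) (h : TwoBlocks x k m c)
    (h' : TwoBlocks (fun i => x (i + 1)) k m' c') : TwoBlocks x (k + 1) m c := by
  have h2 := h.two_le
  have h3 := h.add_two_le
  have h4 := h'.two_le
  have h5 := h'.add_two_le
  have hm : m = m' + 1 := by
    by_contra hne
    apply h.not_commute hc (i := m - 1) (j := m) (by omega) (by omega) (by omega)
    obtain ⟨l, rfl⟩ : ∃ l, m = l + 2 := ⟨m - 2, by omega⟩
    by_cases e : l + 1 < m'
    · exact h'.commute_left (i := l) (j := l + 1) (by omega) (by omega)
    · exact h'.commute_right (i := l) (j := l + 1) (by omega) (by omega) (by omega) (by omega)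
  subst hm
  have hcc : c' = c :=
    mul_left_cancel ((h'.step m' (by omega) (by omega)).symm.trans
      (h.step (m' + 1) (by omega) (by omega)))
  subst hcc
  refine ⟨h2, by omega, ?_, h.comm_zero, h.comm_mid, h.rel⟩
  intro i hi hne
  rcases i with _ | i
  · exact h.step 0 (by omega) hne
  · exact h'.step i (by omega) (by omega)

theorem BSTriple.not_lowTriple {p q r : G} (hne : q ≠ r) (h : BSTriple p q r) :
    ¬ LowTriple p q r :=
  fun h' => hne (mul_left_cancel (h.2.symm.trans h'.2)).symm

theorem BSTriple.not_highTriple {p q r : G} (hne : p ≠ q) (h : BSTriple p q r) :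
    ¬ HighTriple p q r :=
  fun h' => hne (mul_left_cancel (h.1.symm.trans h'.1))

theorem HighTriple.not_lowTriple {p q r : G} (hne : p ≠ q) (h : HighTriple p q r) :
    ¬ LowTriple p q r :=
  fun h' => hne (mul_left_cancel (h.1.symm.trans h'.1)).symm

theorem abelianExcept_four {x : ℕ → G} {p q r y : ℕ} (hcov : ∀ i < 4, i ≠ y → i = p ∨ i = q ∨ i = r)
    (h1 : Commute (x p) (x q)) (h2 : Commute (x p) (x r)) (h3 : Commute (x q) (x r)) :
    AbelianExcept x 4 y := by
  intro i hi j hj hiy hjy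
  rcases hcov i hi hiy with rfl | rfl | rfl <;> rcases hcov j hj hjy with rfl | rfl | rfl <;>
    first
      | exact Commute.refl _
      | assumption
      | exact Commute.symm (by assumption)

variable [LinearOrder G]

/-- An increasing sequence with a nonabelian set of members and few products. -/
structure SmallSeq (x : ℕ → G) (k : ℕ) : Prop where
  inc : IncreasingBelow x k
  nonab : ¬ IsAbelian (seqSet x k)
  card_le : (seqSet x k * seqSet x k).card ≤ 3 * k - 2

theorem noncommuting_of_triples {x : ℕ → G} {k i : ℕ} (hx : IncreasingBelow x k)
    (h : (∀ i, i + 2 < k → BSTriple (x i) (x (i + 1)) (x (i + 2))) ∨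
      (∀ i, i + 2 < k → BSTripleOp (x i) (x (i + 1)) (x (i + 2))) ∨
      (k = 4 ∧ GoldenQuad (x 0) (x 1) (x 2) (x 3)) ∨
      (k = 4 ∧ GoldenQuadOp (x 0) (x 1) (x 2) (x 3))) (hi : i + 2 < k) :
    Noncommuting (x i) (x (i + 1)) (x (i + 2)) := by
  have n1 := hx.ne (i := i) (j := i + 1) (by omega) (by omega) (by omega)
  have n2 := hx.ne (i := i + 1) (j := i + 2) (by omega) (by omega) (by omega)
  have of_inv : PlusForm (x i)⁻¹ (x (i + 1))⁻¹ (x (i + 2))⁻¹ →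
      Noncommuting (x i) (x (i + 1)) (x (i + 2)) := fun h =>
    noncommuting_inv.mp (h.noncommuting (inv_injective.ne n1) (inv_injective.ne n2))
  rcases h with h | h | ⟨rfl, h⟩ | ⟨rfl, h⟩
  · exact PlusForm.noncommuting n1 n2 (Or.inr (Or.inr (h i hi)))
  · exact of_inv (Or.inr (Or.inr (bsTriple_inv.mpr (h i hi))))
  · obtain rfl | rfl : i = 0 ∨ i = 1 := by omega
    · exact PlusForm.noncommuting n1 n2 (Or.inl h.1)
    · exact PlusForm.noncommuting n1 n2 (Or.inr (Or.inl h.2))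
  · have h := goldenQuad_inv.mpr h
    obtain rfl | rfl : i = 0 ∨ i = 1 := by omega
    · exact of_inv (Or.inl h.1)
    · exact of_inv (Or.inr (Or.inl h.2))

theorem TwoBlocks.ne_one {x : ℕ → G} {k m : ℕ} {c : G} (h : TwoBlocks x k m c)
    (hx : IncreasingBelow x k) : c ≠ 1 := by
  rintro rfl
  have h2 := h.two_le
  have h3 := h.add_two_le
  have := h.step 0 (by omega) (by omega)
  rw [mul_one] at this
  exact hx.ne (by omega) (by omega) (by omega) this

variable [MulLeftMono G] [MulRightMono G]

/-- The windows share the indices from `1` to `k - 1`, of which at most two are exceptional. Fewer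
than two ordinary ones remain only if `k = 4` and both exceptions are distinct and lie in the
overlap. -/
theorem exists_two_indices {k y w : ℕ} (hk : 4 ≤ k) (h : ¬ (k = 4 ∧ y ≠ 0 ∧ w ≠ k ∧ y ≠ w)) :
    ∃ p q, p ≠ q ∧ (1 ≤ p ∧ p < k ∧ p ≠ y ∧ p ≠ w) ∧ (1 ≤ q ∧ q < k ∧ q ≠ y ∧ q ≠ w) := by
  by_contra! hcon
  have h1 := hcon 1 2
  have h2 := hcon 1 3
  have h3 := hcon 2 3
  have h4 := hcon 1 4
  have h5 := hcon 2 4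
  have h6 := hcon 3 4
  omega

/-- Two ordinary elements in the overlap make the ordinary elements of one window commute with those
of the other. Exceptions at the two opposite ends are excluded by counting
(`not_isAbelian_of_extend`). -/
theorem abelianExcept_of_abelianExcept {x : ℕ → G} {k y y' : ℕ} (hk : 4 ≤ k)
    (hS : SmallSeq x (k + 1)) (hT : SmallSeq x k) (hT' : SmallSeq (fun i => x (i + 1)) k)
    (hy : y < k) (hy' : y' < k) (h : AbelianExcept x k y)
    (h' : AbelianExcept (fun i => x (i + 1)) k y') :
    ∃ y₀ < k + 1, AbelianExcept x (k + 1) y₀ := by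
  have H' : ∀ i j, 1 ≤ i → i ≤ k → i ≠ y' + 1 → 1 ≤ j → j ≤ k → j ≠ y' + 1 →
      Commute (x i) (x j) := by
    intro i j hi hik hiy hj hjk hjy
    obtain ⟨i, rfl⟩ := Nat.exists_eq_add_of_le' hi
    obtain ⟨j, rfl⟩ := Nat.exists_eq_add_of_le' hj
    exact h' i (by omega) j (by omega) (by omega) (by omega)
  by_cases hmid : y = 0 ∧ y' + 1 = k
  · exfalso
    obtain ⟨rfl, rfl⟩ := hmid
    have e1 : seqSet x (y' + 1) = insert (x 0) (seqSet (fun i => x (i + 1)) y') :=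
      seqSet_succ' x y'
    have e2 : seqSet (fun i => x (i + 1)) (y' + 1) =
        insert (x (y' + 1)) (seqSet (fun i => x (i + 1)) y') := seqSet_succ _ _
    have e3 : seqSet x (y' + 1 + 1) =
        insert (x (y' + 1)) (insert (x 0) (seqSet (fun i => x (i + 1)) y')) := by
      rw [seqSet_succ, e1]
    have hinc : IncreasingBelow (fun i => x (i + 1)) y' :=
      fun i j hij hj => hS.inc _ _ (by omega) (by omega)
    have hcP := hinc.card_seqSet
    have hcard := hS.card_le
    rw [e3] at hcard
    refine not_isAbelian_of_extend (P := seqSet (fun i => x (i + 1)) y') (a := x 0)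
      (y := x (y' + 1)) ?_ ?_ (e1 ▸ hT.nonab) (e2 ▸ hT'.nonab) (by omega) (by omega) ?_
    · intro t ht
      obtain ⟨i, hi, rfl⟩ := mem_seqSet.mp ht
      exact hS.inc _ _ (by omega) (by omega)
    · intro t ht
      obtain ⟨i, hi, rfl⟩ := mem_seqSet.mp ht
      exact hS.inc _ _ (by omega) (by omega)
    · intro a ha b hb
      obtain ⟨i, hi, rfl⟩ := mem_seqSet.mp ha
      obtain ⟨j, hj, rfl⟩ := mem_seqSet.mp hb
      exact H' _ _ (by omega) (by omega) (by omega) (by omega) (by omega) (by omega)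
  by_cases hsp : k = 4 ∧ y ≠ 0 ∧ y' + 1 ≠ k ∧ y ≠ y' + 1
  · exfalso
    obtain ⟨rfl, h0, h4, hne⟩ := hsp
    obtain ⟨p, hp1, hp4, hpy, hpw⟩ : ∃ p, p < 3 ∧ p + 1 < 4 ∧ p + 1 ≠ y ∧ p ≠ y' := by
      by_contra! hcon
      have := hcon 0
      have := hcon 1
      have := hcon 2
      omega
    obtain ⟨v, rfl⟩ := Nat.exists_eq_succ_of_ne_zero h0
    rw [Nat.succ_eq_add_one] at *
    -- Only `x (p + 1)` is ordinary for both windows. Each exceptional element is this one times a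
    -- power of the ratio found in the other window, so a power of each ratio acts on the other
    -- ratio by squaring or its inverse, which `zpow_eq_one_of_conj` forbids.
    have hc1 : Commute (x (v + 1)) (x (p + 1)) :=
      H' _ _ (by omega) (by omega) (by omega) (by omega) (by omega) (by omega)
    have hc2 : Commute (x (y' + 1)) (x (p + 1)) :=
      h _ (by omega) _ (by omega) (by omega) (by omega)
    obtain ⟨c, n, k1, k2, k3, k4⟩ := h.conj_sq hT.inc hy hT.nonab hT.card_le (p := p + 1)
      (w := y' + 1) (by omega) (by omega) (by omega) (by omega) (by omega) hc1
    obtain ⟨e, m, l1, l2, -, l4⟩ := h'.conj_sq hT'.inc hy' hT'.nonab hT'.card_le (p := p)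
      (w := v) (by omega) (by omega) (by omega) (by omega) (by omega) hc2
    rw [l2, conj_eq_of_commute k1] at k4
    rw [k2, conj_eq_of_commute l1] at l4
    exact k3 (zpow_eq_one_of_conj k4 l4)
  obtain ⟨p, q, hpq, ⟨hp1, hp2, hp3, hp4⟩, hq1, hq2, hq3, hq4⟩ := exists_two_indices hk hsp
  have cross : ∀ i j, i < k → i ≠ y → 1 ≤ j → j ≤ k → j ≠ y' + 1 → Commute (x j) (x i) := by
    intro i j hi hiy hj1 hj2 hj3
    exact h.commute_of_two hT.inc hk hy hT.nonab hT.card_le hpq hp2 hq2 hp3 hq3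
      (H' _ _ hj1 hj2 hj3 hp1 hp2.le hp4) (H' _ _ hj1 hj2 hj3 hq1 hq2.le hq4) hi hiy
  have key : ∀ y₀, (∀ i ≤ k, i ≠ y₀ → (i < k ∧ i ≠ y) ∨ (1 ≤ i ∧ i ≠ y' + 1)) →
      AbelianExcept x (k + 1) y₀ := by
    intro y₀ hcov i hi j hj hiy hjy
    rcases hcov i (by omega) hiy with a | a <;> rcases hcov j (by omega) hjy with b | b
    · exact h i a.1 j b.1 a.2 b.2
    · exact (cross i j a.1 a.2 b.1 (by omega) b.2).symm
    · exact cross j i b.1 b.2 a.1 (by omega) a.2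
    · exact H' _ _ a.1 (by omega) a.2 b.1 (by omega) b.2
  by_cases e : y' + 1 = k
  · exact ⟨k, by omega, key k (by omega)⟩
  · exact ⟨y, by omega, key y (by omega)⟩

/-- Pairs from different blocks do not commute, so the exceptional element of the lower window must
be its only member of the right block. The rest is a progression, which prolongs the left block by
`x 0`. -/
theorem twoBlocks_of_abelianExcept_left {x : ℕ → G} {k y m : ℕ} {c : G} (hk : 4 ≤ k)
    (hT : SmallSeq x k) (hc : c ≠ 1)
    (hy : y < k) (h : AbelianExcept x k y) (h' : TwoBlocks (fun i => x (i + 1)) k m c) :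
    TwoBlocks x (k + 1) (m + 1) c := by
  have h2 := h'.two_le
  have h3 := h'.add_two_le
  have nc : ∀ i j, i < m → m ≤ j → j < k → ¬ Commute (x (i + 1)) (x (j + 1)) :=
    fun i j hi hj hjk => h'.not_commute hc hi hj hjk
  have hym : y = m + 1 := by
    by_contra hne
    by_cases e : y = 1
    · exact nc 1 m (by omega) le_rfl (by omega)
        (h _ (by omega) _ (by omega) (by omega) (by omega))
    · exact nc 0 m (by omega) le_rfl (by omega)
        (h _ (by omega) _ (by omega) (by omega) (by omega))
  have hkm : k = m + 2 := by
    by_contra hne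
    exact nc 0 (m + 1) (by omega) (by omega) (by omega)
      (h _ (by omega) _ (by omega) (by omega) (by omega))
  subst hym hkm
  obtain ⟨z, e, he, hze, hP, -⟩ := h.exists_prog hT.inc hk hy hT.nonab hT.card_le
  have hP' : seqSet x (m + 1) = prog z e (m + 1) := by
    have : (range (m + 2)).erase (m + 1) = range (m + 1) := by
      ext i
      simp only [mem_erase, mem_range]
      omega
    rw [seqErase, this] at hP
    exact hP
  have hz := eq_mul_pow_of_seqSet_eq_prog
    (fun i j hij hj => hT.inc i j hij (by omega)) he hP'
  have hstep : ∀ i, i + 1 < m + 1 → x (i + 1) = x i * e := by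
    intro i hi
    rw [hz i (by omega), hz (i + 1) hi, pow_succ, mul_assoc]
  have hec : e = c := by
    have a1 := hstep 1 (by omega)
    have a2 := h'.step 0 (by omega) (by omega)
    exact mul_left_cancel (a1.symm.trans a2)
  subst hec
  have h0 : Commute (x 0) e := by
    rw [hz 0 (by omega), pow_zero, mul_one]; exact hze
  refine ⟨by omega, by omega, ?_, h0, h'.comm_mid, ?_⟩
  · intro i hi hne
    rcases i with _ | i
    · exact hstep 0 (by omega)
    · exact h'.step i (by omega) (by omega)
  · have hm := h'.comm_mid
    have hr := h'.rel
    change Commute (x (m + 1)) e at hm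
    change x 1 * x (m + 1) = x (m + 1) * x 1 * e ∨ x (m + 1) * x 1 = x 1 * x (m + 1) * e at hr
    rw [hstep 0 (by omega)] at hr
    rcases hr with hr | hr
    · left
      rw [mul_assoc, ← hm.eq, ← mul_assoc, ← mul_assoc] at hr
      exact mul_right_cancel hr
    · right
      rw [mul_assoc (x 0), ← hm.eq, ← mul_assoc, ← mul_assoc] at hr
      exact mul_right_cancel hr

/-- The mirror case: the left block is `x 0`, `x 1`, the exceptional element is `x 1`, and the right
block is prolonged by `x k`. -/
theorem twoBlocks_of_abelianExcept_right {x : ℕ → G} {k y m : ℕ} {c : G} (hk : 4 ≤ k)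
    (hT' : SmallSeq (fun i => x (i + 1)) k) (hc : c ≠ 1) (hy : y < k)
    (h : TwoBlocks x k m c) (h' : AbelianExcept (fun i => x (i + 1)) k y) :
    TwoBlocks x (k + 1) m c := by
  have h2 := h.two_le
  have h3 := h.add_two_le
  have H' : ∀ i j, 1 ≤ i → i ≤ k → i ≠ y + 1 → 1 ≤ j → j ≤ k → j ≠ y + 1 →
      Commute (x i) (x j) := by
    intro i j hi hik hiy hj hjk hjy
    obtain ⟨i, rfl⟩ := Nat.exists_eq_add_of_le' hi
    obtain ⟨j, rfl⟩ := Nat.exists_eq_add_of_le' hj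
    exact h' i (by omega) j (by omega) (by omega) (by omega)
  have hym : y + 1 = m - 1 := by
    by_contra hne
    by_cases e : y + 1 = m
    · exact h.not_commute hc (i := m - 1) (j := m + 1) (by omega) (by omega) (by omega)
        (H' _ _ (by omega) (by omega) (by omega) (by omega) (by omega) (by omega))
    · exact h.not_commute hc (i := m - 1) (j := m) (by omega) (by omega) (by omega)
        (H' _ _ (by omega) (by omega) (by omega) (by omega) (by omega) (by omega))
  have hm : m = 2 := by
    by_contra hne
    exact h.not_commute hc (i := m - 2) (j := m) (by omega) (by omega) (by omega)
      (H' _ _ (by omega) (by omega) (by omega) (by omega) (by omega) (by omega))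
  subst hm
  obtain rfl : y = 0 := by omega
  obtain ⟨z, e, he, hze, hP, -⟩ := h'.exists_prog hT'.inc hk hy hT'.nonab hT'.card_le
  have hP' : seqSet (fun i => x (i + 2)) (k - 1) = prog z e (k - 1) := by
    rw [← hP]
    ext g
    simp only [seqErase, mem_seqSet, mem_image, mem_erase, mem_range]
    constructor
    · rintro ⟨i, hi, rfl⟩
      exact ⟨i + 1, ⟨by omega, by omega⟩, rfl⟩
    · rintro ⟨i, ⟨hi, hi'⟩, rfl⟩
      obtain ⟨i, rfl⟩ := Nat.exists_eq_succ_of_ne_zero hi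
      exact ⟨i, by omega, rfl⟩
  have hz := eq_mul_pow_of_seqSet_eq_prog
    (fun i j hij hj => hT'.inc (i + 1) (j + 1) (by omega) (by omega)) he hP'
  have hstep : ∀ i, i + 1 < k - 1 → x (i + 3) = x (i + 2) * e := by
    intro i hi
    rw [hz i (by omega), hz (i + 1) hi, pow_succ, mul_assoc]
  have hec : e = c := by
    have a1 := hstep 0 (by omega)
    have a2 := h.step 2 (by omega) (by omega)
    exact mul_left_cancel (a1.symm.trans a2)
  subst hec
  refine ⟨le_rfl, by omega, ?_, h.comm_zero, h.comm_mid, h.rel⟩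
  intro i hi hne
  rcases i with _ | _ | i
  · exact h.step 0 (by omega) hne
  · omega
  · exact hstep i (by omega)

theorem PlusForm.not_inv {p q r : G} (hpq : p < q) (hqr : q < r) (h : PlusForm p q r) :
    ¬ PlusForm p⁻¹ q⁻¹ r⁻¹ :=
  fun h' => lt_asymm (h.lt hpq hqr).1 (h'.lt_of_inv hpq hqr).1

/-- The windows share `x 1`, `x 2`, `x 3`. The sign of a commutator separates the shapes from their
inverses, and two different shapes of one sign cannot hold for the same triple. In particular golden
quadruples do not extend to five elements. -/
theorem outcome_of_triples {x : ℕ → G} {k : ℕ} (hk : 4 ≤ k) (hx : IncreasingBelow x (k + 1))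
    (h : (∀ i, i + 2 < k → BSTriple (x i) (x (i + 1)) (x (i + 2))) ∨
      (∀ i, i + 2 < k → BSTripleOp (x i) (x (i + 1)) (x (i + 2))) ∨
      (k = 4 ∧ GoldenQuad (x 0) (x 1) (x 2) (x 3)) ∨
      (k = 4 ∧ GoldenQuadOp (x 0) (x 1) (x 2) (x 3)))
    (h' : (∀ i, i + 2 < k → BSTriple (x (i + 1)) (x (i + 2)) (x (i + 3))) ∨
      (∀ i, i + 2 < k → BSTripleOp (x (i + 1)) (x (i + 2)) (x (i + 3))) ∨
      (k = 4 ∧ GoldenQuad (x 1) (x 2) (x 3) (x 4)) ∨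
      (k = 4 ∧ GoldenQuadOp (x 1) (x 2) (x 3) (x 4))) :
    Outcome x (k + 1) := by
  have l1 : x 1 < x 2 := hx 1 2 (by omega) (by omega)
  have l2 : x 2 < x 3 := hx 2 3 (by omega) (by omega)
  have m1 : (x 1)⁻¹ ≠ (x 2)⁻¹ := inv_injective.ne l1.ne
  have m2 : (x 2)⁻¹ ≠ (x 3)⁻¹ := inv_injective.ne l2.ne
  have mixed : PlusForm (x 1) (x 2) (x 3) → PlusForm (x 1)⁻¹ (x 2)⁻¹ (x 3)⁻¹ →
      Outcome x (k + 1) := fun a b => absurd b (a.not_inv l1 l2)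
  have bs : ∀ {p q r : G}, BSTriple p q r → PlusForm p q r := fun h => Or.inr (Or.inr h)
  have hi : ∀ {p q r : G}, HighTriple p q r → PlusForm p q r := fun h => Or.inr (Or.inl h)
  have lo : ∀ {p q r : G}, LowTriple p q r → PlusForm p q r := fun h => Or.inl h
  rcases h with h | h | ⟨rfl, h⟩ | ⟨rfl, h⟩
  · have t := h 1 (by omega)
    rcases h' with h' | h' | ⟨rfl, h'⟩ | ⟨rfl, h'⟩
    · refine Or.inr (Or.inl fun i hi => ?_)
      rcases i with _ | i
      exacts [h 0 (by omega), h' i (by omega)]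
    · exact mixed (bs t) (bs (bsTriple_inv.mpr (h' 0 (by omega))))
    · exact absurd h'.1 (t.not_lowTriple l2.ne)
    · exact mixed (bs t) (lo (goldenQuad_inv.mpr h').1)
  · have t := bsTriple_inv.mpr (h 1 (by omega))
    rcases h' with h' | h' | ⟨rfl, h'⟩ | ⟨rfl, h'⟩
    · exact mixed (bs (h' 0 (by omega))) (bs t)
    · refine Or.inr (Or.inr (Or.inl fun i hi => ?_))
      rcases i with _ | i
      exacts [h 0 (by omega), h' i (by omega)]
    · exact mixed (lo h'.1) (bs t)
    · exact absurd (goldenQuad_inv.mpr h').1 (t.not_lowTriple m2)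
  · have t := h.2
    rcases h' with h' | h' | ⟨-, h'⟩ | ⟨-, h'⟩
    · exact absurd t ((h' 0 (by omega)).not_highTriple l1.ne)
    · exact mixed (hi t) (bs (bsTriple_inv.mpr (h' 0 (by omega))))
    · exact absurd h'.1 (t.not_lowTriple l1.ne)
    · exact mixed (hi t) (lo (goldenQuad_inv.mpr h').1)
  · have t := (goldenQuad_inv.mpr h).2
    rcases h' with h' | h' | ⟨-, h'⟩ | ⟨-, h'⟩
    · exact mixed (bs (h' 0 (by omega))) (hi t)
    · exact absurd t ((bsTriple_inv.mpr (h' 0 (by omega))).not_highTriple m1)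
    · exact mixed (lo h'.1) (hi t)
    · exact absurd (goldenQuad_inv.mpr h').1 (t.not_lowTriple m1)

/-- If deleting an end leaves an abelian set, that end is the exceptional element. Otherwise each
end accounts for at least three products, so both windows satisfy the induction hypothesis. -/
theorem outcome_succ {x : ℕ → G} {k : ℕ} (hk : 4 ≤ k) (hS : SmallSeq x (k + 1))
    (ih : ∀ x : ℕ → G, SmallSeq x k → Outcome x k) : Outcome x (k + 1) := by
  have hcard := hS.card_le
  have hinc : IncreasingBelow x k := fun i j hij hj => hS.inc i j hij (by omega)
  have hinc' : IncreasingBelow (fun i => x (i + 1)) k :=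
    fun i j hij hj => hS.inc _ _ (by omega) (by omega)
  by_cases hA : IsAbelian (seqSet x k)
  · refine Or.inl (Or.inl ⟨k, by omega, fun i hi j hj hik hjk => ?_⟩)
    exact hA _ (mem_seqSet.mpr ⟨i, by omega, rfl⟩) _ (mem_seqSet.mpr ⟨j, by omega, rfl⟩)
  by_cases hA' : IsAbelian (seqSet (fun i => x (i + 1)) k)
  · refine Or.inl (Or.inl ⟨0, by omega, fun i hi j hj hi0 hj0 => ?_⟩)
    obtain ⟨i, rfl⟩ := Nat.exists_eq_succ_of_ne_zero hi0
    obtain ⟨j, rfl⟩ := Nat.exists_eq_succ_of_ne_zero hj0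
    exact hA' _ (mem_seqSet.mpr ⟨i, by omega, rfl⟩) _ (mem_seqSet.mpr ⟨j, by omega, rfl⟩)
  have hT : SmallSeq x k := by
    refine ⟨hinc, hA, ?_⟩
    have hna := hS.nonab
    rw [seqSet_succ] at hcard hna
    have := card_mul_self_add_three_le (T := seqSet x k) (y := x k) (by
      intro t ht
      obtain ⟨i, hi, rfl⟩ := mem_seqSet.mp ht
      exact hS.inc _ _ hi (by omega)) hna
    omega
  have hT' : SmallSeq (fun i => x (i + 1)) k := by
    refine ⟨hinc', hA', ?_⟩
    have hna := hS.nonab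
    rw [seqSet_succ'] at hcard hna
    have := card_mul_self_add_three_le_of_min (T := seqSet (fun i => x (i + 1)) k) (y := x 0) (by
      intro t ht
      obtain ⟨i, hi, rfl⟩ := mem_seqSet.mp ht
      exact hS.inc _ _ (by omega) (by omega)) hna
    omega
  rcases ih x hT with t | t <;> rcases ih _ hT' with t' | t'
  · rcases t with ⟨y, hy, t⟩ | ⟨m, c, t⟩ <;> rcases t' with ⟨y', hy', t'⟩ | ⟨m', c', t'⟩
    · exact Or.inl (Or.inl (abelianExcept_of_abelianExcept hk hS hT hT' hy hy' t t'))
    · exact Or.inl (Or.inr ⟨_, _,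
        twoBlocks_of_abelianExcept_left hk hT (t'.ne_one hinc') hy t t'⟩)
    · exact Or.inl (Or.inr ⟨_, _,
        twoBlocks_of_abelianExcept_right hk hT' (t.ne_one hinc) hy' t t'⟩)
    · exact Or.inl (Or.inr ⟨_, _, twoBlocks_of_twoBlocks (t.ne_one hinc) t t'⟩)
  · exact absurd (noncommuting_of_triples hinc' t' (i := 0) (by omega))
      (not_noncommuting_of_blocks t (i := 1) (by omega))
  · exact absurd (noncommuting_of_triples hinc t (i := 1) (by omega))
      (not_noncommuting_of_blocks t' (i := 0) (by omega))
  · exact outcome_of_triples hk hS.inc t t'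

theorem outcome_four {x : ℕ → G} (hS : SmallSeq x 4) : Outcome x 4 := by
  by_cases hA : ∃ y < 4, AbelianExcept x 4 y
  · exact Or.inl (Or.inl hA)
  have hset := seqSet_four x
  have hcard := hS.card_le
  rw [hset] at hcard
  have hQ : SmallQuad (x 0) (x 1) (x 2) (x 3) :=
    ⟨hS.inc _ _ (by omega) (by omega), hS.inc _ _ (by omega) (by omega),
      hS.inc _ _ (by omega) (by omega),
      fun h1 h2 h3 => hA ⟨3, by omega, abelianExcept_four (by omega) h1 h2 h3⟩,
      fun h1 h2 h3 => hA ⟨2, by omega, abelianExcept_four (by omega) h1 h2 h3⟩,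
      fun h1 h2 h3 => hA ⟨1, by omega, abelianExcept_four (by omega) h1 h2 h3⟩,
      fun h1 h2 h3 => hA ⟨0, by omega, abelianExcept_four (by omega) h1 h2 h3⟩, hcard⟩
  rcases hQ.quad.classification with ⟨e, h1, h2, h3, h4, h5⟩ | ⟨h1, h2⟩ | ⟨h1, h2⟩ | h | h
  · refine Or.inl (Or.inr ⟨2, e, le_rfl, le_rfl, ?_, h3, h4, h5⟩)
    intro i hi hne
    obtain rfl | rfl : i = 0 ∨ i = 2 := by omega
    exacts [h1, h2]
  · refine Or.inr (Or.inl fun i hi => ?_)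
    obtain rfl | rfl : i = 0 ∨ i = 1 := by omega
    exacts [h1, h2]
  · refine Or.inr (Or.inr (Or.inl fun i hi => ?_))
    obtain rfl | rfl : i = 0 ∨ i = 1 := by omega
    exacts [h1, h2]
  · exact Or.inr (Or.inr (Or.inr (Or.inl ⟨rfl, h⟩)))
  · exact Or.inr (Or.inr (Or.inr (Or.inr ⟨rfl, h⟩)))

theorem SmallSeq.outcome {k : ℕ} (hk : 4 ≤ k) : ∀ x : ℕ → G, SmallSeq x k → Outcome x k := by
  induction k, hk using Nat.le_induction with
  | base => exact fun x hx => outcome_four hx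
  | succ k hk ih => exact fun x hx => outcome_succ hk hx ih

end Classification

/-! ### Translation into the listed types, and the converse. -/

section Types

open Finset

variable {G : Type*} [Group G]

theorem comm_eq_one_iff {a b : G} : comm a b = 1 ↔ Commute a b := by
  rw [comm, mul_assoc, ← mul_inv_rev, inv_mul_eq_one]
  exact eq_comm

theorem comm_eq_of_mul_eq {a b c : G} (h : a * b = b * a * c) : comm a b = c := by
  rw [comm, mul_assoc, ← mul_inv_rev, h, inv_mul_cancel_left]

theorem conj_sq_eq (c y : G) : conj (c ^ 2) y = conj c y ^ 2 := by
  simp only [conj, pow_two]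
  group

theorem conj_eq_sq_iff {x c : G} : conj c x = c ^ 2 ↔ c * x = x * c ^ 2 := by
  rw [conj, mul_assoc, inv_mul_eq_iff_eq_mul]

theorem conj_sq_eq_iff {x c : G} : conj (c ^ 2) x = c ↔ c ^ 2 * x = x * c := by
  rw [conj, mul_assoc, inv_mul_eq_iff_eq_mul]

theorem BSTripleOp.exists_ratio {p q r : G} (h : BSTripleOp p q r) :
    ∃ u, q = p * u ∧ r = p * (u * u) ∧ u * u * p = p * u := by
  obtain ⟨h1, h2⟩ := h
  obtain ⟨u, rfl⟩ : ∃ u, q = p * u := ⟨p⁻¹ * q, by group⟩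
  have hr : r = p * (p * u) * p⁻¹ := eq_mul_inv_of_mul_eq h1
  have e : p * u * p⁻¹ = u * u := by
    rw [hr] at h2
    have : p * p * (p * u * p⁻¹) = p * p * (u * u) := by
      calc p * p * (p * u * p⁻¹) = p * (p * (p * u) * p⁻¹) := by group
        _ = p * p * (u * u) := by rw [h2]; group
    exact mul_left_cancel this
  refine ⟨u, rfl, ?_, ?_⟩
  · rw [hr, ← e]; group
  · rw [← e]; group

/-- Consecutive triples overlap in two terms, so their local ratios all equal the first one. -/
theorem eq_mul_pow_of_ratio {x : ℕ → G} {k : ℕ} {u : G} (h1 : x 1 = x 0 * u)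
    (h : ∀ i, i + 2 < k → ∃ v, x (i + 1) = x i * v ∧ x (i + 2) = x i * (v * v)) :
    ∀ i < k, x i = x 0 * u ^ i := by
  have key : ∀ i, i + 1 < k → x (i + 1) = x i * u := by
    intro i
    induction i with
    | zero => exact fun _ => h1
    | succ i ih =>
      intro hi
      obtain ⟨v, h2, h3⟩ := h i (by omega)
      have : v = u := mul_left_cancel (h2.symm.trans (ih (by omega)))
      subst this
      rw [h3, h2, mul_assoc]
  intro i
  induction i with
  | zero => simp
  | succ i ih =>
    intro hi
    rw [key i hi, ih (by omega), pow_succ, mul_assoc]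

theorem seqSet_eq_prog [DecidableEq G] {x : ℕ → G} {k : ℕ} {u : G}
    (h : ∀ i < k, x i = x 0 * u ^ i) : seqSet x k = prog (x 0) u k :=
  image_congr fun i hi => h i (mem_range.mp hi)

theorem prog_three [DecidableEq G] (x c : G) : prog x c 3 = {x, x * c, x * c ^ 2} := by
  ext g
  simp only [prog, mem_image, mem_range, mem_insert, mem_singleton]
  constructor
  · rintro ⟨i, hi, rfl⟩
    interval_cases i <;> simp
  · rintro (rfl | rfl | rfl)
    exacts [⟨0, by omega, by simp⟩, ⟨1, by omega, by simp⟩, ⟨2, by omega, rfl⟩]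

variable [LinearOrder G]

theorem exists_increasingBelow {α : Type*} [LinearOrder α] [Inhabited α] (S : Finset α) :
    ∃ x : ℕ → α, IncreasingBelow x S.card ∧ seqSet x S.card = S := by
  classical
  refine ⟨fun i => if h : i < S.card then S.orderEmbOfFin rfl ⟨i, h⟩ else default, ?_, ?_⟩
  · intro i j hij hj
    simp only [hj, hij.trans hj, dif_pos]
    exact (S.orderEmbOfFin rfl).strictMono hij
  · ext g
    rw [mem_seqSet, ← mem_coe, ← range_orderEmbOfFin S rfl]
    constructor
    · rintro ⟨i, hi, rfl⟩
      simp only [hi, dif_pos]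
      exact ⟨_, rfl⟩
    · rintro ⟨i, rfl⟩
      exact ⟨i, i.2, by simp⟩

theorem exists_smallSeq {S : Finset G} (hna : ¬ IsMulCommutative (Subgroup.closure (S : Set G)))
    (hcard : (S * S).card ≤ 3 * S.card - 2) : ∃ x, SmallSeq x S.card ∧ seqSet x S.card = S := by
  have : Inhabited G := ⟨1⟩
  obtain ⟨x, hx, hS⟩ := exists_increasingBelow S
  refine ⟨x, ⟨hx, ?_, by rwa [hS]⟩, hS⟩
  rw [hS]
  exact fun h => hna (Subgroup.isMulCommutative_closure fun a ha b hb => h a ha b hb)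

variable [MulLeftMono G]

theorem TypeI.of_twoBlocks {x : ℕ → G} {k m : ℕ} {c : G} (h : TwoBlocks x k m c)
    (hx : IncreasingBelow x k) : TypeI (seqSet x k) := by
  have h1 := h.two_le
  have h2 := h.add_two_le
  refine ⟨x 0, x m, c, m - 1, k - m - 1, ?_, comm_eq_one_iff.mpr h.comm_zero,
    comm_eq_one_iff.mpr h.comm_mid, ?_, h.rel⟩
  · ext g
    rw [mem_seqSet, mem_union, mem_prog, mem_prog]
    constructor
    · rintro ⟨i, hi, rfl⟩
      rcases Nat.lt_or_ge i m with him | him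
      · exact Or.inl ⟨i, by omega, (h.left him).symm⟩
      · obtain ⟨j, rfl⟩ := Nat.exists_eq_add_of_le him
        exact Or.inr ⟨j, by omega, (h.right hi).symm⟩
    · rintro (⟨i, hi, rfl⟩ | ⟨i, hi, rfl⟩)
      · exact ⟨i, by omega, h.left (by omega)⟩
      · exact ⟨m + i, by omega, h.right (by omega)⟩
  · have h3 := hx 0 1 (by omega) (by omega)
    rw [h.step 0 (by omega) (by omega)] at h3
    exact (lt_mul_iff_one_lt_right' _).mp h3

theorem TypeII.of_ratio {x : ℕ → G} {k : ℕ} (hk : 4 ≤ k) (hx : IncreasingBelow x k)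
    (h : ∀ i, i + 2 < k → ∃ v, x (i + 1) = x i * v ∧ x (i + 2) = x i * (v * v) ∧
      (v * x i = x i * (v * v) ∨ v * v * x i = x i * v)) : TypeII (seqSet x k) := by
  obtain ⟨u, h1, -, h2⟩ := h 0 (by omega)
  have h3 := hx 0 1 (by omega) (by omega)
  rw [h1] at h3
  have h4 := eq_mul_pow_of_ratio h1 fun i hi => by
    obtain ⟨v, hv, hv', -⟩ := h i hi
    exact ⟨v, hv, hv'⟩
  refine ⟨x 0, u, ?_, (lt_mul_iff_one_lt_right' _).mp h3, ?_⟩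
  · rw [hx.card_seqSet, seqSet_eq_prog h4]
  · rw [conj, conj, pow_two, mul_assoc, mul_assoc, inv_mul_eq_iff_eq_mul, inv_mul_eq_iff_eq_mul]
    exact h2

theorem not_commute_of_conj {x c : G} (hc : c ≠ 1) (h : conj c x = c ^ 2 ∨ conj (c ^ 2) x = c) :
    ¬ Commute c x := by
  intro hcx
  have e : c ^ 2 = c := by
    rcases h with h | h
    · rw [conj_eq_sq_iff, hcx.eq] at h
      exact (mul_left_cancel h).symm
    · rw [conj_sq_eq_iff, (hcx.pow_left 2).eq] at h
      exact mul_left_cancel h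
  rw [pow_two, mul_eq_left] at e
  exact hc e

variable [MulRightMono G]

/-- With `b = a * e` and `f`, `g` the successive conjugates of `e` by `a`, moving every `a` to the
left turns the four relations into `c = a * f`, `g = f * e`, `d = a * (e * f)` and the commutation
of `f` with `e * e`, hence with `e`. -/
theorem GoldenQuad.exists_conj {a b c d : G} (h : GoldenQuad a b c d) :
    ∃ e, b = a * e ∧ c = a * conj e a ∧ d = a * conj e (a ^ 2) ∧
      conj e (a ^ 2) = e * conj e a ∧ e * conj e a = conj e a * e := by
  obtain ⟨⟨h1, h2⟩, h3, h4⟩ := h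
  obtain ⟨e, rfl⟩ : ∃ e, b = a * e := ⟨a⁻¹ * b, by group⟩
  obtain ⟨f, hf⟩ : ∃ f, f = conj e a := ⟨_, rfl⟩
  obtain ⟨g, hg⟩ : ∃ g, g = conj e (a ^ 2) := ⟨_, rfl⟩
  obtain ⟨z, rfl⟩ : ∃ z, d = a * z := ⟨a⁻¹ * d, by group⟩
  have ef : e * a = a * f := by rw [hf, conj]; group
  have fg : f * a = a * g := by rw [hg, hf, conj, conj, pow_two]; group
  have ef' : ∀ w, e * (a * w) = a * (f * w) := fun w => by rw [← mul_assoc, ef, mul_assoc]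
  have fg' : ∀ w, f * (a * w) = a * (g * w) := fun w => by rw [← mul_assoc, fg, mul_assoc]
  have hc : c = a * f := by
    rw [mul_assoc, ef] at h1
    exact mul_left_cancel h1
  subst hc
  have hgfe : g = f * e := by
    simp only [mul_assoc, fg, ef', mul_right_inj] at h2
    exact h2
  have hz : z = e * f := by
    simp only [mul_assoc, ef', fg', mul_right_inj] at h3
    rw [hgfe, mul_assoc] at h3
    exact mul_left_cancel h3
  subst hz
  have hcom : Commute f e := by
    simp only [mul_assoc, ef', fg', mul_right_inj] at h4
    rw [hgfe] at h4
    simp only [mul_assoc, mul_right_inj] at h4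
    refine commute_of_commute_mul_self ?_
    change f * (e * e) = e * e * f
    rw [h4, mul_assoc]
  refine ⟨e, rfl, by rw [← hf], ?_, ?_, ?_⟩
  · rw [← hg, hgfe, hcom.eq]
  · rw [← hg, ← hf, hgfe, hcom.eq]
  · rw [← hf, hcom.eq]

theorem GoldenQuadOp.exists_conj {a b c d : G} (h : GoldenQuadOp a b c d) :
    ∃ e, b = a * e ∧ c = a * conj e a⁻¹ ∧ d = a * conj e (a⁻¹ ^ 2) ∧
      conj e (a⁻¹ ^ 2) = e * conj e a⁻¹ ∧ e * conj e a⁻¹ = conj e a⁻¹ * e := by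
  obtain ⟨⟨h1, h2⟩, h3, h4⟩ := h
  obtain ⟨e, rfl⟩ : ∃ e, b = a * e := ⟨a⁻¹ * b, by group⟩
  obtain ⟨f, hf⟩ : ∃ f, f = conj e a⁻¹ := ⟨_, rfl⟩
  obtain ⟨g, hg⟩ : ∃ g, g = conj e (a⁻¹ ^ 2) := ⟨_, rfl⟩
  obtain ⟨z, rfl⟩ : ∃ z, d = a * z := ⟨a⁻¹ * d, by group⟩
  have ef : a * e = f * a := by simp [hf, conj]
  have fg : a * f = g * a := by simp [hg, hf, conj, pow_two, mul_assoc]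
  have ef' : ∀ w, a * (e * w) = f * (a * w) := fun w => by rw [← mul_assoc, ef, mul_assoc]
  have fg' : ∀ w, a * (f * w) = g * (a * w) := fun w => by rw [← mul_assoc, fg, mul_assoc]
  have hc : c = a * f := by
    apply mul_right_cancel (b := a)
    rw [h1, ef, mul_assoc]
  subst hc
  have hgef : g = e * f := by
    simp only [mul_assoc, mul_right_inj] at h2
    rw [fg, ef, ← mul_assoc] at h2
    exact mul_right_cancel h2
  have hz : z = f * e := by
    simp only [mul_assoc, mul_right_inj] at h3
    rw [ef, fg, ← mul_assoc, ← mul_assoc, mul_left_inj, hgef, ← mul_assoc] at h3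
    exact mul_right_cancel h3
  subst hz
  have hcom : Commute f e := by
    simp only [mul_assoc, mul_right_inj] at h4
    rw [fg', ef, fg, hgef] at h4
    refine commute_of_commute_mul_self ?_
    have : e * e * f * (f * a) = f * (e * e) * (f * a) := by simpa only [mul_assoc] using h4
    exact (mul_right_cancel this).symm
  refine ⟨e, rfl, by rw [← hf], ?_, ?_, ?_⟩
  · rw [← hg, hgef, hcom.eq]
  · rw [← hg, ← hf, hgef]
  · rw [← hf, hcom.eq]

theorem TypeIIIa.of_goldenQuad {x : ℕ → G} (hx : IncreasingBelow x 4)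
    (h : GoldenQuad (x 0) (x 1) (x 2) (x 3) ∨ GoldenQuadOp (x 0) (x 1) (x 2) (x 3)) :
    TypeIIIa (seqSet x 4) := by
  have h01 := hx 0 1 (by omega) (by omega)
  rw [seqSet_four]
  rcases h with h | h
  · obtain ⟨e, h1, h2, h3, h4, h5⟩ := h.exists_conj
    rw [h1] at h01
    refine ⟨x 0, e, Or.inl ?_, (lt_mul_iff_one_lt_right' _).mp h01, h4, h5⟩
    rw [h1, h2, h3]
  · obtain ⟨e, h1, h2, h3, h4, h5⟩ := h.exists_conj
    rw [h1] at h01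
    refine ⟨(x 0)⁻¹, e, Or.inr ?_, (lt_mul_iff_one_lt_right' _).mp h01, h4, h5⟩
    rw [h1, h2, h3, inv_inv]

theorem typeIII_of_abelianExcept {x : ℕ → G} {k y : ℕ} (h : AbelianExcept x k y) (hk : 4 ≤ k)
    (hx : IncreasingBelow x k) (hy : y < k) (hna : ¬ IsAbelian (seqSet x k))
    (hcard : (seqSet x k * seqSet x k).card ≤ 3 * k - 2) :
    TypeI (seqSet x k) ∨
      (k = 4 ∧ (TypeIIIc (seqSet x k) ∨ TypeIIId (seqSet x k))) := by
  obtain ⟨z, c, hc, hzc, hs, hcase⟩ := h.exists_prog hx hk hy hna hcard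
  rw [← insert_seqErase hy, hs]
  rcases hcase with ⟨h1, h2⟩ | ⟨rfl, hcase⟩
  · left
    -- The exceptional element is a block of length one; the other block has length `k - 1`.
    refine ⟨z, x y, c, k - 2, 0, ?_, comm_eq_one_iff.mpr hzc, comm_eq_one_iff.mpr h1.symm, hc, h2⟩
    have : prog (x y) c (0 + 1) = {x y} := by simp [prog]
    rw [this, show k - 2 + 1 = k - 1 by omega, union_comm, ← insert_eq]
  · right
    refine ⟨rfl, ?_⟩
    have hset : insert (x y) (prog z c (4 - 1)) = {z, z * c, z * c ^ 2, x y} := by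
      rw [show 4 - 1 = 3 from rfl, prog_three, insert_comm (x y) z, insert_comm (x y) (z * c),
        pair_comm]
    rw [hset]
    have hcz := comm_eq_one_iff.mpr hzc.symm
    rcases hcase with ⟨e, h1 | h1⟩ | ⟨e, h1 | h1⟩
    · exact Or.inr ⟨z, x y, c, rfl, hcz, comm_eq_one_iff.mpr h1.symm, Or.inl e⟩
    · refine Or.inl ⟨z, x y, c, rfl, hcz, Or.inr ⟨?_, e.symm⟩⟩
      rw [comm_eq_of_mul_eq h1, e]
    · exact Or.inr ⟨z, x y, c, rfl, hcz, comm_eq_one_iff.mpr h1.symm,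
        Or.inr (by rw [conj_sq_eq, ← e])⟩
    · exact Or.inl ⟨z, x y, c, rfl, hcz, Or.inl ⟨comm_eq_of_mul_eq h1, by rw [conj_sq_eq, ← e]⟩⟩

/-- The alternative `TypeIIIb` is never produced: it is the case of `TypeIIId` in which the first
term of the progression is `1`. -/
theorem SmallSeq.classification {x : ℕ → G} {k : ℕ} (hk : 4 ≤ k) (h : SmallSeq x k) :
    TypeI (seqSet x k) ∨ TypeII (seqSet x k) ∨
      (k = 4 ∧ (TypeIIIa (seqSet x k) ∨ TypeIIIb (seqSet x k) ∨ TypeIIIc (seqSet x k) ∨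
        TypeIIId (seqSet x k))) := by
  rcases SmallSeq.outcome hk x h with (⟨y, hy, h1⟩ | ⟨m, c, h1⟩) | h1 | h1 | ⟨rfl, h1⟩ | ⟨rfl, h1⟩
  · have := typeIII_of_abelianExcept h1 hk h.inc hy h.nonab h.card_le
    tauto
  · exact Or.inl (TypeI.of_twoBlocks h1 h.inc)
  · refine Or.inr (Or.inl (TypeII.of_ratio hk h.inc fun i hi => ?_))
    obtain ⟨u, h2, h3, h4⟩ := (h1 i hi).exists_ratio
    exact ⟨u, h2, h3, Or.inl h4⟩
  · refine Or.inr (Or.inl (TypeII.of_ratio hk h.inc fun i hi => ?_))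
    obtain ⟨u, h2, h3, h4⟩ := (h1 i hi).exists_ratio
    exact ⟨u, h2, h3, Or.inr h4⟩
  · exact Or.inr (Or.inr ⟨rfl, Or.inl (TypeIIIa.of_goldenQuad h.inc (Or.inl h1))⟩)
  · exact Or.inr (Or.inr ⟨rfl, Or.inl (TypeIIIa.of_goldenQuad h.inc (Or.inr h1))⟩)

/-- The lower bound holds for every nonabelian set, so each converse only needs few enough values to
cover all products. -/
theorem card_mul_self_eq {S : Finset G} (h : ¬ IsAbelian S)
    (hcard : (S * S).card + 2 ≤ 3 * S.card) :
    (S * S).card = 3 * S.card - 2 := by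
  have := three_mul_card_le h
  omega

theorem TypeI.card_mul_self {S : Finset G} (h : TypeI S) : (S * S).card = 3 * S.card - 2 := by
  obtain ⟨a, b, c, i, j, rfl, hac, hbc, hc, hab⟩ := h
  wlog hr : a * b = b * a * c generalizing a b i j
  · rw [union_comm]
    exact this b a j i hbc hac hab.symm (hab.resolve_left hr)
  rw [comm_eq_one_iff] at hac hbc
  have hn : ¬ Commute a b := fun h => hc.ne' (by rwa [h.eq, left_eq_mul] at hr)
  have ha : a ∈ prog a c (i + 1) := mem_prog.mpr ⟨0, by omega, by simp⟩
  have hb : b ∈ prog b c (j + 1) := mem_prog.mpr ⟨0, by omega, by simp⟩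
  have hdisj : Disjoint (prog a c (i + 1)) (prog b c (j + 1)) := by
    rw [disjoint_left]
    intro g h1 h2
    obtain ⟨m, -, rfl⟩ := mem_prog.mp h1
    obtain ⟨n, -, h⟩ := mem_prog.mp h2
    refine hn (commute_of_mul_right (hac.pow_right n) ?_)
    rw [h]
    exact (Commute.refl a).mul_right (hac.pow_right m)
  refine card_mul_self_eq (fun h => hn (h a (mem_union_left _ ha) b (mem_union_right _ hb))) ?_
  rw [card_union_of_disjoint hdisj, card_prog a hc, card_prog b hc]
  -- Since `a * b = b * a * c`, both kinds of mixed products lie in one progression, whose length is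
  -- `i + j + 2` because of the shift by `c`.
  have hsub : (prog a c (i + 1) ∪ prog b c (j + 1)) * (prog a c (i + 1) ∪ prog b c (j + 1)) ⊆
      (prog (a * a) c (2 * i + 1) ∪ prog (b * b) c (2 * j + 1)) ∪ prog (b * a) c (i + j + 2) := by
    have hm : ∀ {p q : G} (m n : ℕ), Commute q c → p * c ^ m * (q * c ^ n) = p * q * c ^ (m + n) :=
      fun {p q} m n h => by
        rw [pow_add, mul_assoc, ← mul_assoc (c ^ m), ← (h.pow_right m).eq]
        simp only [mul_assoc]
    intro g hg
    obtain ⟨s, hs, t, ht, rfl⟩ := mem_mul.mp hg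
    simp only [mem_union, mem_prog] at hs ht ⊢
    rcases hs with ⟨m, hm1, rfl⟩ | ⟨m, hm1, rfl⟩ <;> rcases ht with ⟨n, hn1, rfl⟩ | ⟨n, hn1, rfl⟩
    · exact Or.inl (Or.inl ⟨m + n, by omega, (hm m n hac).symm⟩)
    · refine Or.inr ⟨m + n + 1, by omega, ?_⟩
      rw [hm m n hbc, hr, pow_succ', mul_assoc _ c]
    · exact Or.inr ⟨m + n, by omega, (hm m n hac).symm⟩
    · exact Or.inl (Or.inr ⟨m + n, by omega, (hm m n hbc).symm⟩)
  have h1 := card_le_card hsub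
  have h2 := card_union_le (prog (a * a) c (2 * i + 1) ∪ prog (b * b) c (2 * j + 1))
    (prog (b * a) c (i + j + 2))
  have h3 := card_union_le (prog (a * a) c (2 * i + 1)) (prog (b * b) c (2 * j + 1))
  simp only [card_prog _ hc] at h2 h3
  omega

theorem TypeII.card_mul_self {S : Finset G} (hS : 2 ≤ S.card) (h : TypeII S) :
    (S * S).card = 3 * S.card - 2 := by
  obtain ⟨x, c, hSx, hc, hrel⟩ := h
  generalize S.card = k at hS hSx
  subst hSx
  have hn := not_commute_of_conj hc.ne' hrel
  have hna : ¬ IsAbelian (prog x c k) := by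
    intro h
    have := h x (mem_prog.mpr ⟨0, by omega, by simp⟩) (x * c) (mem_prog.mpr ⟨1, by omega, by simp⟩)
    exact hn (commute_of_mul_left (Commute.refl x) this).symm
  have hk := card_prog x hc k
  refine (card_mul_self_eq hna ?_).trans (by rw [hk])
  -- Moving the powers of `c` past `x` makes a product depend only on `2 * i + j` or on `i + 2 * j`,
  -- which runs from `0` to `3 * (k - 1)`.
  have key : ∃ f : ℕ → G, prog x c k * prog x c k ⊆ (range (3 * k - 2)).image f := by
    rcases hrel with h | h
    · rw [conj_eq_sq_iff] at h
      have hp : ∀ i, c ^ i * x = x * c ^ (2 * i) := by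
        intro i
        have : SemiconjBy x (c ^ 2) c := h.symm
        rw [pow_mul]
        exact (this.pow_right i).eq.symm
      refine ⟨fun n => x * x * c ^ n, ?_⟩
      intro g hg
      obtain ⟨s, hs, t, ht, rfl⟩ := mem_mul.mp hg
      obtain ⟨i, hi, rfl⟩ := mem_prog.mp hs
      obtain ⟨j, hj, rfl⟩ := mem_prog.mp ht
      refine mem_image.mpr ⟨2 * i + j, mem_range.mpr (by omega), ?_⟩
      rw [pow_add, mul_assoc x (c ^ i), ← mul_assoc (c ^ i), hp]
      simp only [mul_assoc]
    · rw [conj_sq_eq_iff] at h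
      have hp : ∀ i, c ^ (2 * i) * x = x * c ^ i := by
        intro i
        have : SemiconjBy x c (c ^ 2) := h.symm
        rw [pow_mul]
        exact (this.pow_right i).eq.symm
      refine ⟨fun n => x * c ^ n * x, ?_⟩
      intro g hg
      obtain ⟨s, hs, t, ht, rfl⟩ := mem_mul.mp hg
      obtain ⟨i, hi, rfl⟩ := mem_prog.mp hs
      obtain ⟨j, hj, rfl⟩ := mem_prog.mp ht
      refine mem_image.mpr ⟨i + 2 * j, mem_range.mpr (by omega), ?_⟩
      rw [← hp j, pow_add]
      simp only [mul_assoc]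
  obtain ⟨f, hf⟩ := key
  have h1 := (card_le_card hf).trans card_image_le
  rw [card_range] at h1
  omega

theorem TypeIIIb.card_mul_self {S : Finset G} (hS : S.card = 4) (h : TypeIIIb S) :
    (S * S).card = 3 * S.card - 2 := by
  obtain ⟨x, c, rfl, hrel⟩ := h
  have hc : c ≠ 1 := by
    rintro rfl
    have : ({1, 1, 1 ^ 2, x} : Finset G).card ≤ 2 := by simpa using card_le_two
    omega
  have hn := not_commute_of_conj hc hrel
  have hna : ¬ IsAbelian ({1, c, c ^ 2, x} : Finset G) := fun h =>
    hn (h c (by simp) x (by simp))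
  refine card_mul_self_eq hna ?_
  rw [hS]
  have hcc : c ^ 2 * c ^ 2 = c ^ 4 := (pow_add c 2 2).symm
  -- The ten candidates are five powers of `c`, the square of `x`, and four products with exactly
  -- one factor `x`; there are six such products, but the relation between `c` and `x` and the
  -- factor `1` identify some.
  have key : ∃ l : List G, l.length = 10 ∧
      ({1, c, c ^ 2, x} : Finset G) * {1, c, c ^ 2, x} ⊆ l.toFinset := by
    rcases hrel with h | h
    · rw [conj_eq_sq_iff] at h
      refine ⟨[1, c, c ^ 2, c ^ 3, c ^ 4, x * x, x, x * c, x * c ^ 2, x * c ^ 4], rfl, ?_⟩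
      have h2 : c ^ 2 * x = x * c ^ 4 := by
        rw [pow_two, mul_assoc, h, ← mul_assoc, h, mul_assoc, ← pow_add]
      intro g hg
      obtain ⟨s, hs, t, ht, rfl⟩ := mem_mul.mp hg
      simp only [mem_insert, mem_singleton] at hs ht
      rcases hs with rfl | rfl | rfl | rfl <;> rcases ht with rfl | rfl | rfl | rfl <;>
        simp [h, h2, hcc, ← pow_succ, ← pow_succ', ← pow_two]
    · rw [conj_sq_eq_iff] at h
      refine ⟨[1, c, c ^ 2, c ^ 3, c ^ 4, x * x, x, c * x, x * c, x * c ^ 2], rfl, ?_⟩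
      intro g hg
      obtain ⟨s, hs, t, ht, rfl⟩ := mem_mul.mp hg
      simp only [mem_insert, mem_singleton] at hs ht
      rcases hs with rfl | rfl | rfl | rfl <;> rcases ht with rfl | rfl | rfl | rfl <;>
        simp [h, hcc, ← pow_succ, ← pow_succ', ← pow_two]
  obtain ⟨l, hl, hf⟩ := key
  have := (card_le_card hf).trans (List.toFinset_card_le l)
  omega

end Types

end SmallDoubling

/-! ### The classification theorem. -/

theorem theorem1 {G : Type*} [Group G] [LinearOrder G] [MulLeftMono G] [MulRightMono G]
    (S : Finset G) (hS : 4 ≤ S.card) :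
    ((S * S).card = 3 * S.card - 2 →
      ¬ IsMulCommutative (Subgroup.closure (S : Set G)) →
      SmallDoubling.TypeI S ∨ SmallDoubling.TypeII S ∨
        (S.card = 4 ∧
          (SmallDoubling.TypeIIIa S ∨ SmallDoubling.TypeIIIb S ∨
            SmallDoubling.TypeIIIc S ∨ SmallDoubling.TypeIIId S))) ∧
    ((SmallDoubling.TypeI S ∨ SmallDoubling.TypeII S ∨
        (S.card = 4 ∧ SmallDoubling.TypeIIIb S)) →
      (S * S).card = 3 * S.card - 2) := by
  constructor
  · intro hcard hna
    obtain ⟨x, hx, hSx⟩ := SmallDoubling.exists_smallSeq hna hcard.le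
    have := hx.classification hS
    rwa [hSx] at this
  · rintro (h | h | ⟨h4, h⟩)
    · exact h.card_mul_self
    · exact h.card_mul_self (by omega)
    · exact h.card_mul_self h4
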